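/- A chair is the union of three of the four closed unit squares that meet at a point $v\in\mathbb{Z}^2$ (its reflex corner). Write $(v,a)$, with $v\in\mathbb{Z}^2$ and $a\in\{\pm1\}^2$, for the chair with reflex corner $v$ whose missing square is the one in direction $a$ from $v$. The chair inflation rule doubles a chair and dissects it into four chairs, $$(v,a)\;\longmapsto\;\{(2v,a)\}\cup\{(2v+b,-b) : b\in\{\pm1\}^2,\ b\neq a\}.$$ Starting from the seed $\{(b,b): b\in\{\pm1\}^2\}$ (four chairs whose outer corners meet at the origin), which is contained in its own inflation, the iterated inflations increase to a tiling $\mathcal{T}$ of the plane that is fixed by the inflation rule. Code $\mathcal{T}$ by the configuration $x\in\mathcal{A}^{\mathbb{Z}^2}$, $\mathcal{A}=\{\pm1\}^2$, where $x_n$ is the diagonal direction from the centre of the square $n+[0,1]^2$ to the reflex corner of the chair of $\mathcal{T}$ that covers this square. The chair tiling shift $\mathbb{X}$ is the closure of the $\mathbb{Z}^2$-orbit of $x$ under the shifts $(S_iy)_n=y_{n+e_i}$, $i=1,2$. Let $\mathrm{Aut}(\mathbb{X})$ be the group of all self-homeomorphisms of $\mathbb{X}$ and $\mathcal{G}=\langle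 S_1,S_2\rangle\leq\mathrm{Aut}(\mathbb{X})$. The symmetry group $\mathcal{S}(\mathbb{X})$ is the centraliser of $\mathcal{G}$ in $\mathrm{Aut}(\mathbb{X})$, and the extended symmetry group $\mathcal{R}(\mathbb{X})$ is the normaliser of $\mathcal{G}$ in $\mathrm{Aut}(\mathbb{X})$. Let $W_2\leq\mathrm{GL}(2,\mathbb{Z})$ be the group of signed permutation matrices. For $n\in\mathbb{Z}^2$ put $S^n=S_1^{n_1}S_2^{n_2}$. **Theorem.** The $\mathbb{Z}^2$-action on $\mathbb{X}$ is faithful, and the following hold. 1. $\mathbb{X}$ is hypercubic: for every $H\in\mathcal{R}(\mathbb{X})$ there are a permutation $\pi$ of $\{1,2\}$ and signs $\varepsilon_1,\varepsilon_2\in\{\pm1\}$ with $HS_iH^{-1}=S_{\pi(i)}^{\varepsilon_i}$ for $i=1,2$. 2. $\mathbb{X}$ has pure point dynamical spectrum: shift-invariant Borel probability measures on $\mathbb{X}$ exist, and for each such measure $\mu$ the linear span of the joint eigenfunctions of the shift action is dense in $L^2(\mathbb{X},\mu)$. 3. The symmetry group is minimal: $\mathcal{S}(\mathbb{X})=\mathcal{G}\simeq\mathbb{Z}^2$.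 4. $\mathcal{R}(\mathbb{X})=\mathcal{G}\rtimes\mathcal{H}\simeq\mathbb{Z}^2\rtimes\mathcal{H}$ (internal semidirect product) for a subgroup $\mathcal{H}\leq\mathcal{R}(\mathbb{X})$ and an isomorphism $\mathcal{H}\to W_2$, $h\mapsto M_h$, such that $hS^nh^{-1}=S^{M_hn}$ for all $h\in\mathcal{H}$ and $n\in\mathbb{Z}^2$. 5. $W_2\simeq D_4$, the dihedral group of order $8$, and $W_2$ is maximal among the finite subgroups of $\mathrm{GL}(2,\mathbb{Z})$. -/

import Mathlib

open MeasureTheory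

/-! ### Shift spaces over `ℤ^d` -/

/-- The configuration `S^k x` given by `(S^k x)_n = x_{n+k}`; `S^(e_i)` is the `i`-th shift `S_i`. -/
def translateConfig {d : ℕ} {A : Type*} (k : Fin d → ℤ) (x : (Fin d → ℤ) → A) :
    (Fin d → ℤ) → A :=
  fun n => x (n + k)

theorem continuous_translateConfig {d : ℕ} {A : Type*} [TopologicalSpace A] (k : Fin d → ℤ) :
    Continuous (translateConfig k : ((Fin d → ℤ) → A) → ((Fin d → ℤ) → A)) :=
  continuous_pi fun n => continuous_apply (n + k)

/-- A closed, shift-invariant set of configurations over the alphabet `A` (used with `A` finite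
and discrete). -/
structure ZdShift (d : ℕ) (A : Type*) [TopologicalSpace A] where
  carrier : Set ((Fin d → ℤ) → A)
  isClosed : IsClosed carrier
  translate_mem : ∀ (k : Fin d → ℤ), ∀ x ∈ carrier, translateConfig k x ∈ carrier

namespace ZdShift

/-- The points of the shift, with the subspace topology and the subspace σ-algebra. -/
abbrev Pt {d : ℕ} {A : Type*} [TopologicalSpace A] (X : ZdShift d A) : Type _ :=
  {x : (Fin d → ℤ) → A // x ∈ X.carrier}

/-- The smallest shift containing `x`: the closure of its `ℤ^d`-orbit. -/
def orbitClosure {d : ℕ} {A : Type*} [TopologicalSpace A] (x : (Fin d → ℤ) → A) :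
    ZdShift d A where
  carrier := closure (Set.range fun k => translateConfig k x)
  isClosed := isClosed_closure
  translate_mem := by
    intro k y hy
    refine map_mem_closure (continuous_translateConfig k) hy ?_
    rintro _ ⟨l, rfl⟩
    refine ⟨k + l, ?_⟩
    funext n
    simp [translateConfig, add_assoc]

/-- The homeomorphism `S^k` of the shift space. -/
def S {d : ℕ} {A : Type*} [TopologicalSpace A] (X : ZdShift d A) (k : Fin d → ℤ) :
    X.Pt ≃ₜ X.Pt where
  toFun x := ⟨translateConfig k x.1, X.translate_mem k x.1 x.2⟩
  invFun x := ⟨translateConfig (-k) x.1, X.translate_mem (-k) x.1 x.2⟩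
  left_inv x := by
    apply Subtype.ext
    funext n
    simp [translateConfig]
  right_inv x := by
    apply Subtype.ext
    funext n
    simp [translateConfig]
  continuous_toFun :=
    ((continuous_translateConfig k).comp continuous_subtype_val).subtype_mk _
  continuous_invFun :=
    ((continuous_translateConfig (-k)).comp continuous_subtype_val).subtype_mk _

/-- The action of `ℤ^d` as a homomorphism into the group `X.Pt ≃ₜ X.Pt` of all
self-homeomorphisms of the shift space. -/
def action {d : ℕ} {A : Type*} [TopologicalSpace A] (X : ZdShift d A) :
    Multiplicative (Fin d → ℤ) →* (X.Pt ≃ₜ X.Pt) where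
  toFun k := X.S k.toAdd
  map_one' := by
    apply Homeomorph.ext
    intro x
    apply Subtype.ext
    funext n
    simp [S, translateConfig]
  map_mul' k l := by
    apply Homeomorph.ext
    intro x
    apply Subtype.ext
    funext n
    simp [S, translateConfig, add_assoc]

/-- The shift action is faithful, so that `shiftGroup` is isomorphic to `ℤ^d`. -/
def IsFaithful {d : ℕ} {A : Type*} [TopologicalSpace A] (X : ZdShift d A) : Prop :=
  Function.Injective X.action

/-- The group generated by the shifts `S_1, …, S_d`. -/
def shiftGroup {d : ℕ} {A : Type*} [TopologicalSpace A] (X : ZdShift d A) :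
    Subgroup (X.Pt ≃ₜ X.Pt) :=
  X.action.range

/-- The symmetry group: the centraliser of the shift group among all homeomorphisms. -/
def symmetryGroup {d : ℕ} {A : Type*} [TopologicalSpace A] (X : ZdShift d A) :
    Subgroup (X.Pt ≃ₜ X.Pt) :=
  Subgroup.centralizer (X.shiftGroup : Set (X.Pt ≃ₜ X.Pt))

/-- The extended symmetry group: the normaliser of the shift group among all homeomorphisms. -/
def extendedSymmetryGroup {d : ℕ} {A : Type*} [TopologicalSpace A] (X : ZdShift d A) :
    Subgroup (X.Pt ≃ₜ X.Pt) :=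
  Subgroup.normalizer (X.shiftGroup : Set (X.Pt ≃ₜ X.Pt))

/-- `H` acts on the shift group by conjugation as the integer matrix `M`. For a faithful shift
and `H` an extended symmetry there is exactly one such `M`, namely the image of `H` under the
homomorphism from the extended symmetry group to `GL(d, ℤ)`. -/
def ConjActsBy {d : ℕ} {A : Type*} [TopologicalSpace A] (X : ZdShift d A)
    (H : X.Pt ≃ₜ X.Pt) (M : GL (Fin d) ℤ) : Prop :=
  ∀ k : Fin d → ℤ, H * X.S k * H⁻¹ = X.S ((M : Matrix (Fin d) (Fin d) ℤ).mulVec k)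

/-- Every extended symmetry conjugates the generators `S_1, …, S_d` by a signed permutation:
`H S_i H⁻¹ = S_{π(i)}^{ε_i}`. -/
def IsHypercubic {d : ℕ} {A : Type*} [TopologicalSpace A] (X : ZdShift d A) : Prop :=
  ∀ H ∈ X.extendedSymmetryGroup, ∃ (π : Equiv.Perm (Fin d)) (ε : Fin d → ℤˣ),
    ∀ i : Fin d, H * X.S (Pi.single i 1) * H⁻¹ = X.S (Pi.single (π i) 1) ^ (ε i : ℤ)

/-- A shift-invariant Borel probability measure. -/
def IsInvariantProb {d : ℕ} {A : Type*} [TopologicalSpace A] [MeasurableSpace A]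
    (X : ZdShift d A) (μ : Measure X.Pt) : Prop :=
  IsProbabilityMeasure μ ∧ ∀ k : Fin d → ℤ, MeasurePreserving (X.S k) μ μ

/-- `f ∈ L²(μ)` satisfies `f ∘ S^k = χ(k) f` almost everywhere, for all `k` (joint eigenfunction
of the unitary operators induced by the shift action, if nonzero). -/
def IsL2Eigenfunction {d : ℕ} {A : Type*} [TopologicalSpace A] [MeasurableSpace A]
    (X : ZdShift d A) (μ : Measure X.Pt) (f : Lp ℂ 2 μ) : Prop :=
  ∃ χ : (Fin d → ℤ) → ℂ, ∀ k : Fin d → ℤ, (fun x => f (X.S k x)) =ᵐ[μ] fun x => χ k * f x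

/-- Pure point dynamical spectrum: there are invariant probability measures, and for each of them
the eigenfunctions span a dense subspace of `L²`. -/
def HasPurePointSpectrum {d : ℕ} {A : Type*} [TopologicalSpace A] [MeasurableSpace A]
    (X : ZdShift d A) : Prop :=
  (∃ μ : Measure X.Pt, X.IsInvariantProb μ) ∧
    ∀ μ : Measure X.Pt, X.IsInvariantProb μ →
      Dense (Submodule.span ℂ {f : Lp ℂ 2 μ | X.IsL2Eigenfunction μ f} : Set (Lp ℂ 2 μ))

end ZdShift

/-! ### Groups -/

/-- `R` is the internal semidirect product `N ⋊ K` of its subgroups `N` (normal) and `K`. -/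
def IsInternalSemidirect {G : Type*} [Group G] (R N K : Subgroup G) : Prop :=
  N ≤ R ∧ K ≤ R ∧ R ≤ Subgroup.normalizer (N : Set G) ∧ N ⊓ K = ⊥ ∧ N ⊔ K = R

/-- The matrix of the signed permutation `e_j ↦ ε_j e_{π(j)}`. -/
def signedPermMatrix {d : ℕ} (π : Equiv.Perm (Fin d)) (ε : Fin d → ℤˣ) :
    Matrix (Fin d) (Fin d) ℤ :=
  fun i j => if i = π j then (ε j : ℤ) else 0

theorem signedPermMatrix_mul {d : ℕ} (σ π : Equiv.Perm (Fin d)) (η ε : Fin d → ℤˣ) :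
    signedPermMatrix σ η * signedPermMatrix π ε =
      signedPermMatrix (σ * π) (fun j => η (π j) * ε j) := by
  ext i j
  simp only [signedPermMatrix, Matrix.mul_apply, ite_mul, mul_ite, zero_mul, mul_zero]
  rw [Finset.sum_eq_single (π j)]
  · by_cases h : i = σ (π j) <;> simp [h]
  · intro b _ hb
    simp [hb]
  · simp

theorem signedPermMatrix_one {d : ℕ} :
    signedPermMatrix (1 : Equiv.Perm (Fin d)) (fun _ => 1) = 1 := by
  ext i j
  rcases eq_or_ne i j with rfl | h
  · simp [signedPermMatrix, Matrix.one_apply_eq]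
  · simp [signedPermMatrix, Matrix.one_apply_ne h, h]

/-- The hyperoctahedral group `W_d`, in its standard representation by the signed permutation
matrices in `GL(d, ℤ)`. -/
def hyperoctahedral (d : ℕ) : Subgroup (GL (Fin d) ℤ) where
  carrier := {M | ∃ (π : Equiv.Perm (Fin d)) (ε : Fin d → ℤˣ),
    (M : Matrix (Fin d) (Fin d) ℤ) = signedPermMatrix π ε}
  one_mem' := ⟨1, fun _ => 1, by simp [signedPermMatrix_one]⟩
  mul_mem' := by
    rintro M N ⟨σ, η, hM⟩ ⟨π, ε, hN⟩
    exact ⟨σ * π, fun j => η (π j) * ε j, by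
      rw [Units.val_mul, hM, hN, signedPermMatrix_mul]⟩
  inv_mem' := by
    rintro M ⟨π, ε, hM⟩
    refine ⟨π⁻¹, fun j => (ε (π⁻¹ j))⁻¹, ?_⟩
    rw [← Matrix.mul_one ((M⁻¹ : GL (Fin d) ℤ) : Matrix (Fin d) (Fin d) ℤ),
      ← signedPermMatrix_one, ← mul_inv_cancel π]
    have h : (fun _ : Fin d => (1 : ℤˣ)) =
        fun j => ε (π⁻¹ j) * (ε (π⁻¹ j))⁻¹ := by
      funext j
      simp
    rw [h, ← signedPermMatrix_mul, ← hM, ← mul_assoc, ← Units.val_mul]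
    simp

/-! ### The chair tiling -/

/-- The four diagonal directions: `0` is north-east, `1` south-east, `2` south-west and `3`
north-west. The direction opposite to `a` is `a + 2`. -/
def diagDir (a : Fin 4) : Fin 2 → ℤ :=
  ![![1, 1], ![1, -1], ![-1, -1], ![-1, 1]] a

/-- A chair: the union of three of the four closed unit squares that meet at the lattice point
`vertex` (its reflex corner). The missing square is the one in the direction `missing`. -/
structure Chair where
  vertex : Fin 2 → ℤ
  missing : Fin 4

/-- The unit square `n + [0,1]²` belongs to the chair `t` and lies in the direction `b` from its
reflex corner. The first condition compares the doubled centre of the square with the doubled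
vertex. -/
def Chair.HasSquare (t : Chair) (n : Fin 2 → ℤ) (b : Fin 4) : Prop :=
  (2 : ℤ) • n + 1 = (2 : ℤ) • t.vertex + diagDir b ∧ b ≠ t.missing

/-- The chair inflation rule: the doubled chair is dissected into four chairs, one around its
reflex corner with the same orientation, and one in each of its three doubled squares, whose
missing square touches that corner. -/
def chairInflation (T : Set Chair) : Set Chair :=
  {s | ∃ t ∈ T, s = ⟨(2 : ℤ) • t.vertex, t.missing⟩ ∨
    ∃ b, b ≠ t.missing ∧ s = ⟨(2 : ℤ) • t.vertex + diagDir b, b + 2⟩}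

/-- The `D₄`-symmetric seed: four chairs whose outer corners meet at the origin. -/
def chairSeed : Set Chair :=
  {t | ∃ b : Fin 4, t = ⟨diagDir b, b⟩}

/-- The tiling of the plane that is fixed under inflation and emerges from the seed. -/
def chairTiling : Set Chair :=
  ⋃ m : ℕ, chairInflation^[m] chairSeed

open Classical in
/-- The symbolic coding of a chair tiling: the letter at `n` is the direction in which the reflex
corner of the chair covering the square `n + [0,1]²` is seen from the centre of that square. (The
value `0` for a square that is not covered plays no role for a tiling.) -/
noncomputable def chairCode (T : Set Chair) : (Fin 2 → ℤ) → Fin 4 :=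
  fun n => if h : ∃ b : Fin 4, ∃ t ∈ T, t.HasSquare n b then h.choose + 2 else 0

/-- The `ℤ²`-shift of the chair tiling. -/
noncomputable def chairShift : ZdShift 2 (Fin 4) :=
  ZdShift.orbitClosure (chairCode chairTiling)

/-!
In letters, the chair inflation is a block substitution: the square in the position `c` of the
`2 × 2` block that replaces a letter `a` gets the letter `c` if `c = a` and the opposite letter
`c + 2` otherwise (`covers_chairInflation_iff`). The coding `chairFix` of the inflation tiling is
the fixed point of this substitution whose four letters at the origin point outwards. The shift space
is invariant under the substitution, and each of its points is, for every `n`, a translate by some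
vector `z` of an `n` times inflated point. By recognizability (`exists_ne_of_phase_ne`) the vector
`z` is unique modulo `2 ^ n`; it is called the phase of the point, and the phases of all levels
together form the factor map to the `2`-adic odometer, which is used here in finite stages only.

The substitution keeps a letter at the positions of its own parity and forgets it at the other ones.
Hence two letters of the same parity produce blocks of level `n` that differ exactly along one
diagonal of the block, and two points with the same phases differ along diagonal lines
(`HasPhase.diagonal_of_ne`, `SamePhases.exists_segment`). Everything rests on this fact.

* An extended symmetry with matrix `M` moves the set of places where two points differ by `M`, up to
  a bounded error (`Intertwines.exists_near`). There are pairs of points that differ along a single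
  diagonal, and points that differ near a line only have the same phases, because points with
  different phases differ in boxes of bounded size everywhere. So `M` permutes the two diagonal
  directions up to sign, and is a signed permutation (`Intertwines.exists_signedPerm`).
* A symmetry maps pairs that differ along one diagonal to such pairs. This forces the phases of the
  image of `chairFix` to be those of a vector in `ℤ²` (`Intertwines.exists_phase`), so that after a
  shift the symmetry preserves phases. The points of phase zero are determined by their letters at
  the origin, of which none or exactly three point inwards (`legalVertex_of_mem`); a symmetry that
  preserves phases preserves the set of quadrants in which two such points agree. This is possible
  only if it fixes `chairFix`, whose orbit is dense (`Intertwines.fix_chairPt`).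
* The signed permutations act on the centres of the squares and on the letters; they fix `chairFix`
  and split the extended symmetry group (`chairShift_semidirect`).
* A point that shares its phases with another point has a square on the diagonals of its blocks of
  all levels. The set of these points is null for each invariant measure, since suitable translates
  of its pieces are pairwise disjoint (`measure_singularSet`). So almost every point is determined
  by its phases, continuous functions are limits in `L²` of functions of the phases, and these are
  combinations of characters, which are eigenfunctions (`dense_span_eigenfunctions`). An invariant
  measure is a limit of uniform distributions on boxes of an orbit.
-/

/-! ### The substitution on letters -/

/-- The position, inside its aligned `2 × 2` block, of the square `m + [0,1]²`, as a diagonal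
direction from the centre of the block. -/
def blockCorner (m : Fin 2 → ℤ) : Fin 4 :=
  if m 0 % 2 = 0 then (if m 1 % 2 = 0 then 2 else 3) else (if m 1 % 2 = 0 then 1 else 0)

/-- The index of the aligned `2 × 2` block that contains the square `m + [0,1]²`. -/
def blockIndex (m : Fin 2 → ℤ) : Fin 2 → ℤ := fun i => m i / 2

/-- The chair inflation on letters: the letter at the position `c` of the block that replaces the
letter `a`. The sub-square next to the reflex corner keeps its letter, the other three point to the
centre of the block. -/
def chairSubst (a c : Fin 4) : Fin 4 := if c = a then c else c + 2

/-- The chair inflation on configurations. -/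
def inflate (y : (Fin 2 → ℤ) → Fin 4) : (Fin 2 → ℤ) → Fin 4 :=
  fun m => chairSubst (y (blockIndex m)) (blockCorner m)

/-- The lower left corner of the unit square that touches the origin and lies in the quadrant
`d`. -/
def quadrantSquare (d : Fin 4) : Fin 2 → ℤ := ![![0, 0], ![0, -1], ![-1, -1], ![-1, 0]] d

/-- The defining relation between a square, its block and its position in the block, in terms of
doubled centres. -/
theorem blockCorner_eq_iff (m : Fin 2 → ℤ) (c : Fin 4) :
    blockCorner m = c ↔ (2 : ℤ) • m + 1 = (2 : ℤ) • ((2 : ℤ) • blockIndex m + 1) + diagDir c := by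
  have h : ((2 : ℤ) • m + 1 = (2 : ℤ) • ((2 : ℤ) • blockIndex m + 1) + diagDir c) ↔
      (2 * m 0 + 1 = 2 * (2 * (m 0 / 2) + 1) + diagDir c 0 ∧
        2 * m 1 + 1 = 2 * (2 * (m 1 / 2) + 1) + diagDir c 1) := by
    rw [funext_iff, Fin.forall_fin_two]; simp [blockIndex, mul_add]
  rw [h]
  unfold blockCorner
  fin_cases c <;> simp [diagDir] <;> split_ifs <;> simp <;> omega

theorem centre_eq (m : Fin 2 → ℤ) :
    (2 : ℤ) • m + 1 = (2 : ℤ) • ((2 : ℤ) • blockIndex m + 1) + diagDir (blockCorner m) :=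
  (blockCorner_eq_iff m _).1 rfl

theorem diagDir_eq (d : Fin 4) : diagDir d = (2 : ℤ) • quadrantSquare d + 1 := by
  funext i; fin_cases d <;> fin_cases i <;> simp [diagDir, quadrantSquare]

theorem diagDir_add_two (d : Fin 4) : diagDir (d + 2) = - diagDir d := by
  funext i; fin_cases d <;> fin_cases i <;> simp [diagDir]

theorem diagDir_injective : Function.Injective diagDir := by
  intro a b h
  have h0 := congrFun h 0
  have h1 := congrFun h 1
  revert h0 h1
  fin_cases a <;> fin_cases b <;> simp [diagDir]

/-- The doubled centre of a square determines its block and its position in the block. -/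
theorem blockIndex_blockCorner_unique {m n : Fin 2 → ℤ} {c : Fin 4}
    (h : (2 : ℤ) • m + 1 = (2 : ℤ) • ((2 : ℤ) • n + 1) + diagDir c) :
    blockIndex m = n ∧ blockCorner m = c := by
  have hn : blockIndex m = n := by
    have h' : ∀ i, 2 * m i + 1 = 2 * (2 * n i + 1) + diagDir c i := fun i => by
      simpa [mul_add] using congrFun h i
    have hc : ∀ i, diagDir c i = 1 ∨ diagDir c i = -1 := by
      intro i; fin_cases c <;> fin_cases i <;> simp [diagDir]
    funext i
    have := h' i; have := hc i
    simp only [blockIndex]; omega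
  subst hn
  exact ⟨rfl, (blockCorner_eq_iff m c).2 h⟩

/-! ### The coding of the inflation tiling -/

/-- Some chair of `T` covers the square at `n` in such a way that the square has the letter `a`. -/
def Covers (T : Set Chair) (n : Fin 2 → ℤ) (a : Fin 4) : Prop :=
  ∃ t ∈ T, t.HasSquare n (a + 2)

theorem add_two_add_two (a : Fin 4) : a + 2 + 2 = a := by revert a; decide

/-- The inflation rule for chairs, read on letters, is the substitution `chairSubst`. -/
theorem covers_chairInflation_iff (T : Set Chair) (m : Fin 2 → ℤ) (a : Fin 4) :
    Covers (chairInflation T) m a ↔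
      ∃ a', Covers T (blockIndex m) a' ∧ a = chairSubst a' (blockCorner m) := by
  constructor
  · rintro ⟨s, ⟨t, ht, rfl | ⟨b, hb, rfl⟩⟩, hs, hne⟩
    · -- `s` has the reflex corner of `t`
      have key : (2 : ℤ) • m + 1 = (2 : ℤ) • ((2 : ℤ) • (t.vertex + quadrantSquare (a + 2)) + 1)
          + diagDir a := by
        rw [hs, diagDir_eq, ← add_two_add_two a, diagDir_add_two (a + 2), diagDir_eq,
          add_two_add_two]
        module
      obtain ⟨h1, h2⟩ := blockIndex_blockCorner_unique key
      refine ⟨a, ⟨t, ht, ?_, hne⟩, ?_⟩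
      · rw [h1, diagDir_eq]; module
      · simp [chairSubst, h2]
    · -- the reflex corner of `s` is the centre of a doubled square of `t`
      have key : (2 : ℤ) • m + 1 = (2 : ℤ) • ((2 : ℤ) • (t.vertex + quadrantSquare b) + 1)
          + diagDir (a + 2) := by
        rw [hs]; simp only [diagDir_eq b]; module
      obtain ⟨h1, h2⟩ := blockIndex_blockCorner_unique key
      refine ⟨b + 2, ⟨t, ht, ?_, by rwa [add_two_add_two]⟩, ?_⟩
      · rw [h1, add_two_add_two, diagDir_eq]; module
      · simp only at hne
        simp [chairSubst, h2, hne, add_two_add_two]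
  · rintro ⟨a', ⟨t, ht, h, hne⟩, rfl⟩
    have hm := centre_eq m
    rw [h] at hm
    by_cases hc : blockCorner m = a'
    · refine ⟨_, ⟨t, ht, Or.inl rfl⟩, ?_, ?_⟩
      · simp only [chairSubst, hc, if_true]
        rw [hm, hc, diagDir_add_two]; module
      · simpa [chairSubst, hc] using hne
    · refine ⟨_, ⟨t, ht, Or.inr ⟨a' + 2, hne, rfl⟩⟩, ?_, ?_⟩
      · simp only [chairSubst, hc, if_false]
        rw [hm, add_two_add_two]
      · simp [chairSubst, hc]


theorem chairSeed_subset : chairSeed ⊆ chairInflation chairSeed := by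
  rintro _ ⟨b, rfl⟩
  refine ⟨⟨diagDir b, b⟩, ⟨b, rfl⟩, Or.inr ⟨b + 2, by revert b; decide, ?_⟩⟩
  rw [add_two_add_two, diagDir_add_two]
  congr 1
  module

theorem chairInflation_mono {T U : Set Chair} (h : T ⊆ U) : chairInflation T ⊆ chairInflation U :=
  fun _ ⟨t, ht, hs⟩ => ⟨t, h ht, hs⟩

theorem monotone_chairInflation_iterate : Monotone fun m : ℕ => chairInflation^[m] chairSeed := by
  refine monotone_nat_of_le_succ fun m => ?_
  induction m with
  | zero => exact chairSeed_subset
  | succ m ih =>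
    rw [Function.iterate_succ_apply', Function.iterate_succ_apply']
    exact chairInflation_mono ih

theorem chairInflation_chairTiling : chairInflation chairTiling = chairTiling := by
  apply Set.Subset.antisymm
  · rintro s ⟨t, ht, hs⟩
    obtain ⟨m, hm⟩ := Set.mem_iUnion.1 ht
    refine Set.mem_iUnion.2 ⟨m + 1, ?_⟩
    rw [Function.iterate_succ_apply']
    exact ⟨t, hm, hs⟩
  · rintro s hs
    obtain ⟨m, hm⟩ := Set.mem_iUnion.1 hs
    have := monotone_chairInflation_iterate (Nat.le_succ m) hm
    simp only [Nat.succ_eq_add_one, Function.iterate_succ_apply'] at this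
    exact chairInflation_mono (Set.subset_iUnion _ m) this

theorem covers_chairSeed_unique {n : Fin 2 → ℤ} {a a' : Fin 4} (h : Covers chairSeed n a)
    (h' : Covers chairSeed n a') : a = a' := by
  obtain ⟨_, ⟨b, rfl⟩, h1, h2⟩ := h
  obtain ⟨_, ⟨b', rfl⟩, h1', h2'⟩ := h'
  rw [h1'] at h1
  have e0 := congrFun h1 0
  have e1 := congrFun h1 1
  clear h1 h1'
  revert h2 h2' e0 e1
  simp only [Pi.add_apply, Pi.smul_apply, smul_eq_mul]
  revert a a' b b'
  decide

theorem covers_iterate_unique (j : ℕ) {n : Fin 2 → ℤ} {a a' : Fin 4}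
    (h : Covers (chairInflation^[j] chairSeed) n a)
    (h' : Covers (chairInflation^[j] chairSeed) n a') : a = a' := by
  induction j generalizing n a a' with
  | zero => exact covers_chairSeed_unique h h'
  | succ j ih =>
    rw [Function.iterate_succ_apply', covers_chairInflation_iff] at h h'
    obtain ⟨b, hb, rfl⟩ := h
    obtain ⟨b', hb', rfl⟩ := h'
    rw [ih hb hb']

/-- The chairs of the inflation tiling do not overlap. -/
theorem covers_chairTiling_unique {n : Fin 2 → ℤ} {a a' : Fin 4}
    (h : Covers chairTiling n a) (h' : Covers chairTiling n a') : a = a' := by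
  obtain ⟨t, ht, hs⟩ := h
  obtain ⟨t', ht', hs'⟩ := h'
  obtain ⟨i, hi⟩ := Set.mem_iUnion.1 ht
  obtain ⟨j, hj⟩ := Set.mem_iUnion.1 ht'
  exact covers_iterate_unique (max i j)
    ⟨t, monotone_chairInflation_iterate (le_max_left i j) hi, hs⟩
    ⟨t', monotone_chairInflation_iterate (le_max_right i j) hj, hs'⟩

theorem covers_quadrantSquare (d : Fin 4) : Covers chairTiling (quadrantSquare d) d := by
  refine ⟨⟨diagDir d, d⟩, Set.mem_iUnion.2 ⟨0, d, rfl⟩, ?_, ?_⟩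
  · rw [diagDir_add_two, ← diagDir_eq]; module
  · revert d; decide

/-- Induction along the block hierarchy: every square reaches one of the four squares at the origin
by passing to larger and larger blocks. -/
theorem block_induction {P : (Fin 2 → ℤ) → Prop} (base : ∀ d, P (quadrantSquare d))
    (step : ∀ m, P (blockIndex m) → P m) (m : Fin 2 → ℤ) : P m := by
  induction hN : (m 0).natAbs + (m 1).natAbs using Nat.strong_induction_on generalizing m with
  | _ N ih =>
    by_cases h : (m 0 = 0 ∨ m 0 = -1) ∧ (m 1 = 0 ∨ m 1 = -1)
    · obtain ⟨d, hd⟩ : ∃ d, m = quadrantSquare d := by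
        obtain ⟨h0 | h0, h1 | h1⟩ := h
        · exact ⟨0, by funext i; fin_cases i <;> simp [quadrantSquare, h0, h1]⟩
        · exact ⟨1, by funext i; fin_cases i <;> simp [quadrantSquare, h0, h1]⟩
        · exact ⟨3, by funext i; fin_cases i <;> simp [quadrantSquare, h0, h1]⟩
        · exact ⟨2, by funext i; fin_cases i <;> simp [quadrantSquare, h0, h1]⟩
      rw [hd]; exact base d
    · refine step m (ih _ ?_ _ rfl)
      simp only [blockIndex]
      omega

theorem exists_covers_chairTiling (n : Fin 2 → ℤ) : ∃ a, Covers chairTiling n a := by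
  refine block_induction (P := fun n => ∃ a, Covers chairTiling n a)
    (fun d => ⟨d, covers_quadrantSquare d⟩) (fun m ⟨a, ha⟩ => ?_) n
  refine ⟨chairSubst a (blockCorner m), ?_⟩
  rw [← chairInflation_chairTiling, covers_chairInflation_iff]
  exact ⟨a, ha, rfl⟩

/-- The coding of the inflation tiling. -/
noncomputable abbrev chairFix : (Fin 2 → ℤ) → Fin 4 := chairCode chairTiling

theorem covers_chairFix (n : Fin 2 → ℤ) : Covers chairTiling n (chairFix n) := by
  have h : ∃ b : Fin 4, ∃ t ∈ chairTiling, t.HasSquare n b := by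
    obtain ⟨a, t, ht, hs⟩ := exists_covers_chairTiling n
    exact ⟨_, t, ht, hs⟩
  have : chairFix n = h.choose + 2 := by
    simp only [chairFix, chairCode, dif_pos h]
  obtain ⟨t, ht, hs⟩ := h.choose_spec
  exact ⟨t, ht, by rwa [this, add_two_add_two]⟩

theorem chairFix_quadrantSquare (d : Fin 4) : chairFix (quadrantSquare d) = d :=
  covers_chairTiling_unique (covers_chairFix _) (covers_quadrantSquare d)

theorem inflate_chairFix : inflate chairFix = chairFix := by
  funext m
  refine covers_chairTiling_unique ?_ (covers_chairFix m)
  rw [← chairInflation_chairTiling, covers_chairInflation_iff]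
  exact ⟨_, covers_chairFix _, rfl⟩

/-- A fixed point of the inflation is determined by its four letters at the origin. -/
theorem eq_of_inflate_eq {y y' : (Fin 2 → ℤ) → Fin 4} (h : inflate y = y) (h' : inflate y' = y')
    (hq : ∀ d, y (quadrantSquare d) = y' (quadrantSquare d)) : y = y' := by
  funext m
  refine block_induction (P := fun m => y m = y' m) hq (fun m ih => ?_) m
  rw [← h, ← h']
  simp only [inflate, ih]

/-! ### Iterated inflation and recognizability -/

theorem inflate_translate (k : Fin 2 → ℤ) (y : (Fin 2 → ℤ) → Fin 4) :
    translateConfig ((2 : ℤ) • k) (inflate y) = inflate (translateConfig k y) := by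
  funext m
  have h := centre_eq m
  have : (2 : ℤ) • (m + (2 : ℤ) • k) + 1 =
      (2 : ℤ) • ((2 : ℤ) • (blockIndex m + k) + 1) + diagDir (blockCorner m) := by
    rw [smul_add, add_right_comm, h]; module
  obtain ⟨h1, h2⟩ := blockIndex_blockCorner_unique this
  simp only [translateConfig, inflate, h1, h2]

theorem translateConfig_translateConfig (k l : Fin 2 → ℤ) (y : (Fin 2 → ℤ) → Fin 4) :
    translateConfig k (translateConfig l y) = translateConfig (k + l) y := by
  funext m; simp [translateConfig, add_assoc]

theorem translateConfig_zero (y : (Fin 2 → ℤ) → Fin 4) : translateConfig 0 y = y := by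
  funext m; simp [translateConfig]

theorem translateConfig_injective (k : Fin 2 → ℤ) :
    Function.Injective (translateConfig k : ((Fin 2 → ℤ) → Fin 4) → _) := by
  intro y y' h
  have := congrArg (translateConfig (-k)) h
  simpa [translateConfig_translateConfig, translateConfig_zero] using this

theorem inflate_iterate_translate (n : ℕ) (k : Fin 2 → ℤ) (y : (Fin 2 → ℤ) → Fin 4) :
    translateConfig ((2 ^ n : ℤ) • k) (inflate^[n] y) = inflate^[n] (translateConfig k y) := by
  induction n generalizing k with
  | zero => simp
  | succ n ih =>
    rw [Function.iterate_succ_apply', Function.iterate_succ_apply', ← ih, ← inflate_translate,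
      smul_smul, pow_succ']

theorem exists_square_of_block (n : Fin 2 → ℤ) (c : Fin 4) :
    ∃ m, blockIndex m = n ∧ blockCorner m = c ∧ ∀ i, 2 * n i ≤ m i ∧ m i ≤ 2 * n i + 1 := by
  refine ⟨(2 : ℤ) • n + 1 + quadrantSquare c, ?_⟩
  have h := @blockIndex_blockCorner_unique ((2 : ℤ) • n + 1 + quadrantSquare c) n c
    (by rw [diagDir_eq]; module)
  refine ⟨h.1, h.2, fun i => ?_⟩
  have : quadrantSquare c i = 0 ∨ quadrantSquare c i = -1 := by
    fin_cases c <;> fin_cases i <;> simp [quadrantSquare]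
  simp only [Pi.add_apply, Pi.smul_apply, Pi.one_apply, smul_eq_mul]
  omega

/-- Different letters produce blocks that differ at some position. -/
theorem exists_inflate_ne {y y' : (Fin 2 → ℤ) → Fin 4} {n : Fin 2 → ℤ} (h : y n ≠ y' n) :
    ∃ m, (∀ i, 2 * n i ≤ m i ∧ m i ≤ 2 * n i + 1) ∧ inflate y m ≠ inflate y' m := by
  obtain ⟨m, h1, h2, h3⟩ := exists_square_of_block n (y n)
  refine ⟨m, h3, ?_⟩
  simp only [inflate, h1, h2]
  generalize y n = a at h
  generalize y' n = b at h
  revert a b; decide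

theorem inflate_injective : Function.Injective inflate := by
  intro y y' h
  funext n
  by_contra hne
  obtain ⟨m, -, hm⟩ := exists_inflate_ne hne
  exact hm (congrFun h m)

/-- The two letters have the same parity: both point along the main diagonal, or both along the
antidiagonal. -/
def SameParity (a b : Fin 4) : Prop := (a : ℕ) % 2 = (b : ℕ) % 2

instance (a b : Fin 4) : Decidable (SameParity a b) := inferInstanceAs (Decidable (_ = _))

theorem sameParity_chairSubst (a c : Fin 4) : SameParity (chairSubst a c) c := by
  revert a c; decide

theorem chairSubst_of_sameParity {a c : Fin 4} (h : SameParity a c) : chairSubst a c = a := by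
  revert a c; decide

theorem chairSubst_of_not_sameParity {a c : Fin 4} (h : ¬ SameParity a c) :
    chairSubst a c = c + 2 := by
  revert a c; decide

/-- Where the positions in the first two levels of blocks have different parities, a twice inflated
configuration does not depend on the original one. -/
theorem inflate_inflate_of_not_sameParity {m : Fin 2 → ℤ}
    (h : ¬ SameParity (blockCorner (blockIndex m)) (blockCorner m)) (y : (Fin 2 → ℤ) → Fin 4) :
    inflate (inflate y) m = blockCorner m + 2 := by
  refine chairSubst_of_not_sameParity fun h' => h ?_
  have := sameParity_chairSubst (y (blockIndex (blockIndex m))) (blockCorner (blockIndex m))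
  exact this.symm.trans h'

/-- The finite check behind recognizability: positions modulo `4` decide some letters of a twice
inflated configuration, and the patterns of decided letters that belong to different phases modulo
`2` contradict each other. -/
theorem recognizability_mod_four : ∀ u v : Fin 4 × Fin 4,
    ((u.1 : ℕ) % 2 ≠ (v.1 : ℕ) % 2 ∨ (u.2 : ℕ) % 2 ≠ (v.2 : ℕ) % 2) →
    ∃ j : Fin 4 × Fin 4,
      ¬ SameParity (blockCorner (blockIndex ![(u.1 : ℤ) + j.1, u.2 + j.2]))
        (blockCorner ![(u.1 : ℤ) + j.1, u.2 + j.2]) ∧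
      ¬ SameParity (blockCorner (blockIndex ![(v.1 : ℤ) + j.1, v.2 + j.2]))
        (blockCorner ![(v.1 : ℤ) + j.1, v.2 + j.2]) ∧
      blockCorner ![(u.1 : ℤ) + j.1, u.2 + j.2] ≠ blockCorner ![(v.1 : ℤ) + j.1, v.2 + j.2] := by
  decide +kernel

theorem blockCorner_congr {m m' : Fin 2 → ℤ} (h : ∀ i, m i % 2 = m' i % 2) :
    blockCorner m = blockCorner m' := by
  simp only [blockCorner, h]

theorem exists_fin_four (a : ℤ) : ∃ u : Fin 4, a % 4 = (u : ℕ) :=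
  ⟨⟨(a % 4).toNat, by omega⟩, by simp only; omega⟩

/-- Recognizability: in every `4 × 4` box, two twice inflated configurations that are shifted by
amounts different modulo `2` disagree. -/
theorem exists_ne_of_phase_ne {p p' : Fin 2 → ℤ} (h : ∃ i, p i % 2 ≠ p' i % 2)
    (k₀ : Fin 2 → ℤ) :
    ∃ k, (∀ i, k₀ i ≤ k i ∧ k i < k₀ i + 4) ∧ ∀ y y' : (Fin 2 → ℤ) → Fin 4,
      translateConfig p (inflate (inflate y)) k ≠ translateConfig p' (inflate (inflate y')) k := by
  obtain ⟨u0, hu0⟩ := exists_fin_four (k₀ 0 + p 0)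
  obtain ⟨u1, hu1⟩ := exists_fin_four (k₀ 1 + p 1)
  obtain ⟨v0, hv0⟩ := exists_fin_four (k₀ 0 + p' 0)
  obtain ⟨v1, hv1⟩ := exists_fin_four (k₀ 1 + p' 1)
  obtain ⟨j, h1, h2, h3⟩ := recognizability_mod_four (u0, u1) (v0, v1) (by
    rw [Fin.exists_fin_two] at h
    simp only
    omega)
  simp only at h1 h2 h3
  have c1 : blockCorner (k₀ + ![(j.1 : ℤ), j.2] + p) = blockCorner ![(u0 : ℤ) + j.1, u1 + j.2] :=
    blockCorner_congr (by
      rw [Fin.forall_fin_two]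
      simp only [Pi.add_apply, Matrix.cons_val_zero, Matrix.cons_val_one]
      omega)
  have c2 : blockCorner (k₀ + ![(j.1 : ℤ), j.2] + p') = blockCorner ![(v0 : ℤ) + j.1, v1 + j.2] :=
    blockCorner_congr (by
      rw [Fin.forall_fin_two]
      simp only [Pi.add_apply, Matrix.cons_val_zero, Matrix.cons_val_one]
      omega)
  have c3 : blockCorner (blockIndex (k₀ + ![(j.1 : ℤ), j.2] + p)) =
      blockCorner (blockIndex ![(u0 : ℤ) + j.1, u1 + j.2]) :=
    blockCorner_congr (by
      rw [Fin.forall_fin_two]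
      simp only [blockIndex, Pi.add_apply, Matrix.cons_val_zero, Matrix.cons_val_one]
      omega)
  have c4 : blockCorner (blockIndex (k₀ + ![(j.1 : ℤ), j.2] + p')) =
      blockCorner (blockIndex ![(v0 : ℤ) + j.1, v1 + j.2]) :=
    blockCorner_congr (by
      rw [Fin.forall_fin_two]
      simp only [blockIndex, Pi.add_apply, Matrix.cons_val_zero, Matrix.cons_val_one]
      omega)
  refine ⟨k₀ + ![(j.1 : ℤ), j.2], ?_, fun y y' => ?_⟩
  · rw [Fin.forall_fin_two]
    have := j.1.2; have := j.2.2
    simp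
  · rw [translateConfig, translateConfig,
      inflate_inflate_of_not_sameParity (by rw [c1, c3]; exact h1),
      inflate_inflate_of_not_sameParity (by rw [c2, c4]; exact h2), c1, c2]
    intro h; exact h3 (add_right_cancel h)

/-! ### Diagonals of blocks -/

/-- The square `m` lies, inside its aligned block of size `2 ^ n`, on the diagonal that runs in the
direction of the letter `a`, that is, on the main diagonal for `a = 0, 2` and on the antidiagonal
for `a = 1, 3`. -/
def OnDiagonal (n : ℕ) (a : Fin 4) (m : Fin 2 → ℤ) : Prop :=
  if (a : ℕ) % 2 = 0 then (2 ^ n : ℤ) ∣ m 0 - m 1 else (2 ^ n : ℤ) ∣ m 0 + m 1 + 1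

theorem OnDiagonal.congr {n : ℕ} {a b : Fin 4} {m : Fin 2 → ℤ} (h : OnDiagonal n a m)
    (hab : SameParity a b) : OnDiagonal n b m := by
  unfold SameParity at hab
  unfold OnDiagonal at *
  rwa [← hab]

theorem two_pow_succ_dvd_iff (n : ℕ) (t : ℤ) :
    (2 ^ (n + 1) : ℤ) ∣ t ↔ t % 2 = 0 ∧ (2 ^ n : ℤ) ∣ t / 2 := by
  rw [pow_succ']
  constructor
  · rintro ⟨k, rfl⟩
    rw [mul_assoc]
    exact ⟨by omega, by simp⟩
  · rintro ⟨h, k, hk⟩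
    exact ⟨k, by rw [mul_assoc, ← hk]; omega⟩

theorem blockCorner_parity (m : Fin 2 → ℤ) : ((blockCorner m : ℕ) : ℤ) % 2 = (m 0 + m 1) % 2 := by
  unfold blockCorner
  split_ifs <;> simp <;> omega

theorem onDiagonal_succ (n : ℕ) (a : Fin 4) (m : Fin 2 → ℤ) :
    OnDiagonal (n + 1) a m ↔ OnDiagonal n a (blockIndex m) ∧ SameParity a (blockCorner m) := by
  unfold OnDiagonal SameParity
  simp only [two_pow_succ_dvd_iff, blockIndex]
  have hc := blockCorner_parity m
  split_ifs with ha
  · constructor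
    · rintro ⟨h1, h2⟩
      exact ⟨by rwa [show m 0 / 2 - m 1 / 2 = (m 0 - m 1) / 2 by omega], by omega⟩
    · rintro ⟨h1, h2⟩
      have h3 : (m 0 - m 1) % 2 = 0 := by omega
      exact ⟨h3, by rwa [show (m 0 - m 1) / 2 = m 0 / 2 - m 1 / 2 by omega]⟩
  · constructor
    · rintro ⟨h1, h2⟩
      exact ⟨by rwa [show m 0 / 2 + m 1 / 2 + 1 = (m 0 + m 1 + 1) / 2 by omega], by omega⟩
    · rintro ⟨h1, h2⟩
      have h3 : (m 0 + m 1 + 1) % 2 = 0 := by omega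
      exact ⟨h3, by rwa [show (m 0 + m 1 + 1) / 2 = m 0 / 2 + m 1 / 2 + 1 by omega]⟩

/-- The inflated block of a letter is constant along the diagonal in the direction of the
letter. -/
theorem inflate_iterate_of_onDiagonal {n : ℕ} {y : (Fin 2 → ℤ) → Fin 4} {m : Fin 2 → ℤ}
    (h : OnDiagonal n (y (blockIndex^[n] m)) m) : inflate^[n] y m = y (blockIndex^[n] m) := by
  induction n generalizing m with
  | zero => rfl
  | succ n ih =>
    rw [Function.iterate_succ_apply blockIndex] at h ⊢
    rw [onDiagonal_succ] at h
    rw [Function.iterate_succ_apply']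
    simp only [inflate]
    rw [ih h.1, chairSubst_of_sameParity h.2]

/-- The inflated blocks of two letters of the same parity agree off one diagonal of the block. -/
theorem onDiagonal_of_inflate_iterate_ne {n : ℕ} {y y' : (Fin 2 → ℤ) → Fin 4} {m : Fin 2 → ℤ}
    (hp : SameParity (y (blockIndex^[n] m)) (y' (blockIndex^[n] m)))
    (h : inflate^[n] y m ≠ inflate^[n] y' m) : OnDiagonal n (y (blockIndex^[n] m)) m := by
  induction n generalizing m with
  | zero => unfold OnDiagonal; simp
  | succ n ih =>
    rw [Function.iterate_succ_apply blockIndex] at hp ⊢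
    simp only [Function.iterate_succ_apply', inflate] at h
    have h1 := ih hp (fun e => h (by rw [e]))
    have h2 := inflate_iterate_of_onDiagonal h1
    have h3 := inflate_iterate_of_onDiagonal (h1.congr hp)
    rw [onDiagonal_succ]
    refine ⟨h1, ?_⟩
    by_contra h4
    rw [h2, h3, chairSubst_of_not_sameParity h4,
      chairSubst_of_not_sameParity fun h5 => h4 (Eq.trans hp h5)] at h
    exact h rfl

theorem blockIndex_iterate_apply (n : ℕ) (m : Fin 2 → ℤ) (i : Fin 2) :
    (blockIndex^[n] m) i = m i / 2 ^ n := by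
  induction n generalizing m with
  | zero => simp
  | succ n ih =>
    rw [Function.iterate_succ_apply, ih, blockIndex, pow_succ', Int.ediv_ediv_of_nonneg (by simp)]

/-! ### Phases -/

theorem exists_eq_two_smul {r : Fin 2 → ℤ} (h : ∀ i, r i % 2 = 0) : ∃ l, r = (2 : ℤ) • l :=
  ⟨fun i => r i / 2, by
    funext i; have := h i; simp only [Pi.smul_apply, smul_eq_mul]; omega⟩

theorem continuous_inflate : Continuous inflate :=
  continuous_pi fun m =>
    (continuous_of_discreteTopology (f := fun a => chairSubst a (blockCorner m))).comp
      (continuous_apply (blockIndex m))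

theorem chairFix_mem : chairFix ∈ chairShift.carrier :=
  subset_closure ⟨0, translateConfig_zero _⟩

theorem translate_chairFix_mem (k : Fin 2 → ℤ) :
    translateConfig k chairFix ∈ chairShift.carrier :=
  chairShift.translate_mem k _ chairFix_mem

/-- Induction principle for the points of the shift space: a closed property of the translates of
the inflation tiling holds everywhere. -/
theorem chairShift_induction {P : Set ((Fin 2 → ℤ) → Fin 4)} (hP : IsClosed P)
    (h : ∀ k, translateConfig k chairFix ∈ P) {y : (Fin 2 → ℤ) → Fin 4}
    (hy : y ∈ chairShift.carrier) : y ∈ P :=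
  closure_minimal (Set.range_subset_iff.2 h) hP hy

theorem inflate_mem {y : (Fin 2 → ℤ) → Fin 4} (hy : y ∈ chairShift.carrier) :
    inflate y ∈ chairShift.carrier := by
  refine chairShift_induction (P := inflate ⁻¹' chairShift.carrier)
    (chairShift.isClosed.preimage continuous_inflate) (fun k => ?_) hy
  rw [Set.mem_preimage, ← inflate_translate, inflate_chairFix]
  exact translate_chairFix_mem _

theorem inflate_iterate_mem {y : (Fin 2 → ℤ) → Fin 4} (hy : y ∈ chairShift.carrier) (n : ℕ) :
    inflate^[n] y ∈ chairShift.carrier := by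
  induction n with
  | zero => exact hy
  | succ n ih => rw [Function.iterate_succ_apply']; exact inflate_mem ih

theorem isCompact_chairShift : IsCompact chairShift.carrier := chairShift.isClosed.isCompact

/-- Every point of the shift space is a translate of an inflated point. -/
theorem exists_eq_translate_inflate {y : (Fin 2 → ℤ) → Fin 4} (hy : y ∈ chairShift.carrier) :
    ∃ r, ∃ w ∈ chairShift.carrier, y = translateConfig r (inflate w) := by
  have hclosed : IsClosed (⋃ c : Fin 4, (fun w => translateConfig (quadrantSquare c) (inflate w)) ''
      chairShift.carrier) :=
    isClosed_iUnion_of_finite fun c =>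
      (isCompact_chairShift.image ((continuous_translateConfig _).comp continuous_inflate)).isClosed
  have := chairShift_induction hclosed (fun k => ?_) hy
  · obtain ⟨c, w, hw, rfl⟩ := Set.mem_iUnion.1 this
    exact ⟨_, w, hw, rfl⟩
  · -- `k` is even up to one of the four vectors `quadrantSquare c`
    obtain ⟨c, l, rfl⟩ : ∃ c l, k = quadrantSquare c + (2 : ℤ) • l := by
      obtain ⟨c, hc⟩ : ∃ c, ∀ i, (k i - quadrantSquare c i) % 2 = 0 := by
        simp only [Fin.forall_fin_two]
        rcases Int.emod_two_eq_zero_or_one (k 0) with h0 | h0 <;>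
          rcases Int.emod_two_eq_zero_or_one (k 1) with h1 | h1
        · exact ⟨0, by simp [quadrantSquare]; omega⟩
        · exact ⟨1, by simp [quadrantSquare]; omega⟩
        · exact ⟨3, by simp [quadrantSquare]; omega⟩
        · exact ⟨2, by simp [quadrantSquare]; omega⟩
      obtain ⟨l, hl⟩ := exists_eq_two_smul (r := k - quadrantSquare c) hc
      exact ⟨c, l, by rw [← hl]; simp⟩
    refine Set.mem_iUnion.2 ⟨c, translateConfig l chairFix, translate_chairFix_mem l, ?_⟩
    simp only
    rw [← inflate_translate, inflate_chairFix, translateConfig_translateConfig]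

/-- The point `y` is the translate by `z` of an `n` times inflated point: it is composed of inflated
blocks of size `2 ^ n`, positioned by `z`. -/
def HasPhase (n : ℕ) (z : Fin 2 → ℤ) (y : (Fin 2 → ℤ) → Fin 4) : Prop :=
  ∃ w ∈ chairShift.carrier, y = translateConfig z (inflate^[n] w)

theorem HasPhase.mem {n : ℕ} {z : Fin 2 → ℤ} {y : (Fin 2 → ℤ) → Fin 4} (h : HasPhase n z y) :
    y ∈ chairShift.carrier := by
  obtain ⟨w, hw, rfl⟩ := h
  exact chairShift.translate_mem _ _ (inflate_iterate_mem hw n)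

theorem HasPhase.add {n : ℕ} {z : Fin 2 → ℤ} {y : (Fin 2 → ℤ) → Fin 4} (h : HasPhase n z y)
    (k : Fin 2 → ℤ) : HasPhase n (z + (2 ^ n : ℤ) • k) y := by
  obtain ⟨w, hw, rfl⟩ := h
  refine ⟨translateConfig (-k) w, chairShift.translate_mem _ _ hw, ?_⟩
  rw [← inflate_iterate_translate, translateConfig_translateConfig]
  congr 1; module

theorem HasPhase.congr {n : ℕ} {z z' : Fin 2 → ℤ} {y : (Fin 2 → ℤ) → Fin 4} (h : HasPhase n z y)
    (hz : ∀ i, (2 ^ n : ℤ) ∣ z' i - z i) : HasPhase n z' y := by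
  choose k hk using hz
  convert h.add k using 1
  funext i
  simp only [Pi.add_apply, Pi.smul_apply, smul_eq_mul, ← hk]; ring

theorem HasPhase.translate {n : ℕ} {z : Fin 2 → ℤ} {y : (Fin 2 → ℤ) → Fin 4} (h : HasPhase n z y)
    (k : Fin 2 → ℤ) : HasPhase n (k + z) (translateConfig k y) := by
  obtain ⟨w, hw, rfl⟩ := h
  exact ⟨w, hw, by rw [translateConfig_translateConfig]⟩

theorem HasPhase.of_succ {n : ℕ} {z : Fin 2 → ℤ} {y : (Fin 2 → ℤ) → Fin 4}
    (h : HasPhase (n + 1) z y) : HasPhase n z y := by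
  obtain ⟨w, hw, rfl⟩ := h
  exact ⟨inflate w, inflate_mem hw, by rw [Function.iterate_succ_apply]⟩

theorem HasPhase.of_le {n N : ℕ} (hn : n ≤ N) {z : Fin 2 → ℤ} {y : (Fin 2 → ℤ) → Fin 4}
    (h : HasPhase N z y) : HasPhase n z y := by
  induction N, hn using Nat.le_induction with
  | base => exact h
  | succ N _ ih => exact ih h.of_succ

theorem exists_hasPhase {y : (Fin 2 → ℤ) → Fin 4} (hy : y ∈ chairShift.carrier) (n : ℕ) :
    ∃ z, HasPhase n z y := by
  induction n with
  | zero => exact ⟨0, y, hy, by simp [translateConfig_zero]⟩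
  | succ n ih =>
    obtain ⟨z, w, hw, rfl⟩ := ih
    obtain ⟨r, w', hw', rfl⟩ := exists_eq_translate_inflate hw
    refine ⟨z + (2 ^ n : ℤ) • r, w', hw', ?_⟩
    rw [← inflate_iterate_translate, translateConfig_translateConfig, Function.iterate_succ_apply]

/-- The two configurations agree on arbitrarily large boxes. -/
def AgreeOnBoxes (y y' : (Fin 2 → ℤ) → Fin 4) : Prop :=
  ∀ N : ℕ, ∃ m : Fin 2 → ℤ, ∀ k, (∀ i, m i ≤ k i ∧ k i < m i + N) → y k = y' k

theorem AgreeOnBoxes.refl (y : (Fin 2 → ℤ) → Fin 4) : AgreeOnBoxes y y :=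
  fun _ => ⟨0, fun _ _ => rfl⟩

theorem AgreeOnBoxes.translate {y y' : (Fin 2 → ℤ) → Fin 4} (h : AgreeOnBoxes y y')
    (l : Fin 2 → ℤ) : AgreeOnBoxes (translateConfig l y) (translateConfig l y') := by
  intro N
  obtain ⟨m, hm⟩ := h N
  refine ⟨m - l, fun k hk => hm _ fun i => ?_⟩
  have := hk i
  simp only [Pi.sub_apply, Pi.add_apply] at *
  omega

theorem AgreeOnBoxes.of_inflate {y y' : (Fin 2 → ℤ) → Fin 4}
    (h : AgreeOnBoxes (inflate y) (inflate y')) : AgreeOnBoxes y y' := by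
  intro N
  obtain ⟨m, hm⟩ := h (2 * N + 2)
  refine ⟨fun i => (m i + 1) / 2, fun q hq => ?_⟩
  by_contra hne
  obtain ⟨k, hk, hk'⟩ := exists_inflate_ne hne
  refine hk' (hm k fun i => ?_)
  have h1 : (m i + 1) / 2 ≤ q i ∧ q i < (m i + 1) / 2 + N := hq i
  have := hk i
  push_cast
  omega

/-- Two translates of inflated points that agree on large boxes have the same phase modulo `2`. -/
theorem phase_eq_of_agreeOnBoxes {w w' : (Fin 2 → ℤ) → Fin 4} (hw : w ∈ chairShift.carrier)
    (hw' : w' ∈ chairShift.carrier) {r r' : Fin 2 → ℤ}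
    (h : AgreeOnBoxes (translateConfig r (inflate w)) (translateConfig r' (inflate w')))
    (i : Fin 2) :
    r i % 2 = r' i % 2 := by
  obtain ⟨s, v, -, rfl⟩ := exists_eq_translate_inflate hw
  obtain ⟨s', v', -, rfl⟩ := exists_eq_translate_inflate hw'
  rw [← inflate_translate, ← inflate_translate, translateConfig_translateConfig,
    translateConfig_translateConfig] at h
  by_contra hne
  obtain ⟨m, hm⟩ := h 4
  obtain ⟨k, hk, hk'⟩ := exists_ne_of_phase_ne (p := r + (2 : ℤ) • s) (p' := r' + (2 : ℤ) • s')
    ⟨i, by simp only [Pi.add_apply, Pi.smul_apply, smul_eq_mul]; omega⟩ m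
  exact hk' v v' (hm k fun i => by simpa using hk i)

/-- Points that agree on large boxes have the same phases. -/
theorem HasPhase.of_agreeOnBoxes {n : ℕ} {z : Fin 2 → ℤ} {y y' : (Fin 2 → ℤ) → Fin 4}
    (h : HasPhase n z y) (hy' : y' ∈ chairShift.carrier) (ha : AgreeOnBoxes y y') :
    HasPhase n z y' := by
  suffices H : ∀ w ∈ chairShift.carrier, y = translateConfig z (inflate^[n] w) →
      ∃ w' ∈ chairShift.carrier, y' = translateConfig z (inflate^[n] w') ∧ AgreeOnBoxes w w' by
    obtain ⟨w, hw, rfl⟩ := h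
    obtain ⟨w', hw', rfl, -⟩ := H w hw rfl
    exact ⟨w', hw', rfl⟩
  clear h
  induction n with
  | zero =>
    rintro w hw rfl
    have := ha.translate (-z)
    simp only [Function.iterate_zero, id, translateConfig_translateConfig, neg_add_cancel,
      translateConfig_zero] at this
    exact ⟨translateConfig (-z) y', chairShift.translate_mem _ _ hy',
      by simp [translateConfig_translateConfig, translateConfig_zero], this⟩
  | succ n ih =>
    intro w hw hwy
    rw [Function.iterate_succ_apply] at hwy
    obtain ⟨v, hv, hvy, hag⟩ := ih _ (inflate_mem hw) hwy
    obtain ⟨r, v', hv', rfl⟩ := exists_eq_translate_inflate hv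
    have hr : ∀ i, r i % 2 = 0 := fun i =>
      (phase_eq_of_agreeOnBoxes hw hv' (r := 0) (by rwa [translateConfig_zero]) i).symm.trans rfl
    obtain ⟨l, rfl⟩ := exists_eq_two_smul hr
    rw [inflate_translate] at hvy hag
    exact ⟨_, chairShift.translate_mem _ _ hv', by rw [Function.iterate_succ_apply, ← hvy],
      hag.of_inflate⟩

theorem inflate_iterate_injective (n : ℕ) : Function.Injective (inflate^[n]) :=
  inflate_injective.iterate n

/-- The phase of a point is unique modulo `2 ^ n`. -/
theorem HasPhase.unique {n : ℕ} {z z' : Fin 2 → ℤ} {y : (Fin 2 → ℤ) → Fin 4} (h : HasPhase n z y)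
    (h' : HasPhase n z' y) : ∀ i, (2 ^ n : ℤ) ∣ z i - z' i := by
  induction n generalizing z z' with
  | zero => simp
  | succ n ih =>
    choose k hk using ih h.of_succ h'.of_succ
    obtain rfl : z = z' + (2 ^ n : ℤ) • k := by
      funext i; have := hk i; simp only [Pi.add_apply, Pi.smul_apply, smul_eq_mul]; lia
    obtain ⟨w, hw, hy⟩ := h
    obtain ⟨w', hw', hy'⟩ := h'
    rw [Function.iterate_succ_apply] at hy hy'
    rw [← translateConfig_translateConfig, inflate_iterate_translate, hy'] at hy
    have he := inflate_iterate_injective n (translateConfig_injective _ hy)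
    have hk2 : ∀ i, k i % 2 = 0 := fun i => by
      have := phase_eq_of_agreeOnBoxes hw' hw (r := 0) (r' := k)
        (by rw [translateConfig_zero, ← he]; exact AgreeOnBoxes.refl _) i
      exact this.symm
    intro i
    rw [hk i, pow_succ]
    exact mul_dvd_mul_left _ (Int.dvd_of_emod_eq_zero (hk2 i))

/-! ### Pairs of points with the same phases -/

/-- If two points with the same phase differ at a square, this square lies on a diagonal of its
block of size `2 ^ n`, and the two points are constant, with their different letters, along this
diagonal. -/
theorem HasPhase.diagonal_of_ne {n : ℕ} {z k : Fin 2 → ℤ} {y y' : (Fin 2 → ℤ) → Fin 4}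
    (h : HasPhase (n + 1) z y) (h' : HasPhase (n + 1) z y') (hne : y k ≠ y' k) :
    OnDiagonal n (y k) (k + z) ∧
      ∀ l, blockIndex^[n] (l + z) = blockIndex^[n] (k + z) → OnDiagonal n (y k) (l + z) →
        y l = y k ∧ y' l = y' k := by
  obtain ⟨w, -, rfl⟩ := h
  obtain ⟨w', -, rfl⟩ := h'
  simp only [translateConfig, Function.iterate_succ_apply] at *
  have hp : SameParity (inflate w (blockIndex^[n] (k + z))) (inflate w' (blockIndex^[n] (k + z))) :=
    (sameParity_chairSubst _ _).trans (sameParity_chairSubst _ _).symm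
  have h1 := onDiagonal_of_inflate_iterate_ne hp hne
  have h2 := inflate_iterate_of_onDiagonal h1
  have h3 := inflate_iterate_of_onDiagonal (h1.congr hp)
  rw [h2, h3]
  refine ⟨h1, fun l hl hd => ?_⟩
  rw [← hl] at hd hp ⊢
  exact ⟨inflate_iterate_of_onDiagonal hd, inflate_iterate_of_onDiagonal (hd.congr hp)⟩

/-- The two points have the same phases at all levels. -/
def SamePhases (y y' : (Fin 2 → ℤ) → Fin 4) : Prop :=
  ∀ n, ∃ z, HasPhase n z y ∧ HasPhase n z y'

theorem SamePhases.hasPhase {y y' : (Fin 2 → ℤ) → Fin 4} (h : SamePhases y y') {n : ℕ}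
    {z : Fin 2 → ℤ} (hz : HasPhase n z y) : HasPhase n z y' := by
  obtain ⟨z', h1, h2⟩ := h n
  exact h2.congr fun i => hz.unique h1 i

theorem AgreeOnBoxes.samePhases {y y' : (Fin 2 → ℤ) → Fin 4} (h : AgreeOnBoxes y y')
    (hy : y ∈ chairShift.carrier) (hy' : y' ∈ chairShift.carrier) : SamePhases y y' := fun n =>
  let ⟨z, hz⟩ := exists_hasPhase hy n
  ⟨z, hz, hz.of_agreeOnBoxes hy' h⟩

/-- The direction of the diagonals on which a letter is constant, up to sign. -/
def letterLine (a : Fin 4) : Fin 2 → ℤ := if (a : ℕ) % 2 = 0 then ![1, 1] else ![1, -1]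

/-- Two points with the same phases that differ at a square differ along arbitrarily long diagonal
segments. -/
theorem SamePhases.exists_segment {y y' : (Fin 2 → ℤ) → Fin 4} (h : SamePhases y y')
    {k : Fin 2 → ℤ} (hne : y k ≠ y' k) (n : ℕ) :
    ∃ m : Fin 2 → ℤ, ∀ j : ℤ, 0 ≤ j → j < 2 ^ n →
      y (m + j • letterLine (y k)) ≠ y' (m + j • letterLine (y k)) := by
  obtain ⟨z, hz, hz'⟩ := h (n + 1)
  obtain ⟨h1, h2⟩ := hz.diagonal_of_ne hz' hne
  have hpos : (0 : ℤ) < 2 ^ n := by positivity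
  have hdiv : ∀ q t : ℤ, 0 ≤ t → t < 2 ^ n → (2 ^ n * q + t) / 2 ^ n = q := fun q t h0 ht => by
    rw [Int.mul_add_ediv_left _ _ hpos.ne', Int.ediv_eq_zero_of_lt h0 ht, add_zero]
  -- `t` is the distance from the beginning of the diagonal of the block
  have ht := Int.mul_ediv_add_emod (k 0 + z 0) (2 ^ n)
  have ht0 := Int.emod_nonneg (k 0 + z 0) hpos.ne'
  have ht1 := Int.emod_lt_of_pos (k 0 + z 0) hpos
  set t := (k 0 + z 0) % 2 ^ n
  set q := (k 0 + z 0) / 2 ^ n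
  refine ⟨k - t • letterLine (y k), fun j hj0 hj => ?_⟩
  have key := h2 (k - t • letterLine (y k) + j • letterLine (y k)) ?_ ?_
  · rw [key.1, key.2]; exact hne
  · funext i
    rw [blockIndex_iterate_apply, blockIndex_iterate_apply]
    unfold OnDiagonal at h1
    unfold letterLine
    split_ifs at h1 ⊢ with hpar <;> obtain ⟨c, hc⟩ := h1 <;> revert i <;>
      rw [Fin.forall_fin_two] <;>
      simp only [Pi.add_apply, Pi.sub_apply, Pi.smul_apply, smul_eq_mul, Matrix.cons_val_zero,
        Matrix.cons_val_one] at hc ⊢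
    · constructor
      · rw [show k 0 - t * 1 + j * 1 + z 0 = 2 ^ n * q + j by linarith, hdiv _ _ hj0 hj]
      · rw [show k 1 - t * 1 + j * 1 + z 1 = 2 ^ n * (q - c) + j by linarith, hdiv _ _ hj0 hj,
          show k 1 + z 1 = 2 ^ n * (q - c) + t by linarith, hdiv _ _ ht0 ht1]
    · constructor
      · rw [show k 0 - t * 1 + j * 1 + z 0 = 2 ^ n * q + j by linarith, hdiv _ _ hj0 hj]
      · rw [show k 1 - t * -1 + j * -1 + z 1 = 2 ^ n * (c - q - 1) + (2 ^ n - 1 - j) by linarith,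
          hdiv _ _ (by linarith) (by linarith),
          show k 1 + z 1 = 2 ^ n * (c - q - 1) + (2 ^ n - 1 - t) by linarith,
          hdiv _ _ (by linarith) (by linarith)]
  · unfold OnDiagonal at h1 ⊢
    unfold letterLine
    split_ifs at h1 ⊢ with hpar
    all_goals
      convert h1 using 1
      simp only [Pi.add_apply, Pi.sub_apply, Pi.smul_apply, smul_eq_mul, Matrix.cons_val_zero,
        Matrix.cons_val_one]
      ring

theorem sameParity_add_two (d : Fin 4) : SameParity (d + 2) d := by revert d; decide

/-! ### Legal vertices -/

/-- The letters of the four squares around a vertex, listed by quadrants, are such that none or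
exactly three of them point to the vertex: the vertex is not a reflex corner, or it is the reflex
corner of one chair. -/
def LegalVertex (u : Fin 4 → Fin 4) : Prop :=
  (Finset.univ.filter fun d => u d = d + 2).card = 0 ∨
    (Finset.univ.filter fun d => u d = d + 2).card = 3

theorem legalVertex_congr {u u' : Fin 4 → Fin 4} (h : ∀ d, u d = d + 2 ↔ u' d = d + 2) :
    LegalVertex u ↔ LegalVertex u' := by
  unfold LegalVertex
  simp only [h]

theorem blockIndex_blockCorner_vertex_even (v : Fin 2 → ℤ) (d : Fin 4) :
    blockIndex ((2 : ℤ) • v + quadrantSquare d) = v + quadrantSquare d ∧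
      blockCorner ((2 : ℤ) • v + quadrantSquare d) = d + 2 := by
  apply blockIndex_blockCorner_unique
  rw [diagDir_add_two, diagDir_eq]; module

theorem blockIndex_blockCorner_vertex_odd (v : Fin 2 → ℤ) (d : Fin 4) :
    blockIndex ((2 : ℤ) • v + 1 + quadrantSquare d) = v ∧
      blockCorner ((2 : ℤ) • v + 1 + quadrantSquare d) = d := by
  apply blockIndex_blockCorner_unique
  rw [diagDir_eq]; module

theorem legalVertex_inflate_even (y : (Fin 2 → ℤ) → Fin 4) (v : Fin 2 → ℤ) :
    LegalVertex (fun d => inflate y ((2 : ℤ) • v + quadrantSquare d)) ↔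
      LegalVertex (fun d => y (v + quadrantSquare d)) := by
  apply legalVertex_congr
  intro d
  simp only [inflate, blockIndex_blockCorner_vertex_even]
  generalize y (v + quadrantSquare d) = a
  revert a d; decide

theorem legalVertex_inflate_odd (y : (Fin 2 → ℤ) → Fin 4) (v : Fin 2 → ℤ) :
    LegalVertex (fun d => inflate y ((2 : ℤ) • v + 1 + quadrantSquare d)) := by
  simp only [inflate, blockIndex_blockCorner_vertex_odd]
  generalize y v = a
  unfold LegalVertex
  revert a; decide

/-- At a vertex on the boundary of exactly two blocks no letter points to or away from the
vertex. -/
theorem legalVertex_inflate_mixed (y : (Fin 2 → ℤ) → Fin 4) {v : Fin 2 → ℤ}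
    (hv : (v 0 + v 1) % 2 = 1) : LegalVertex (fun d => inflate y (v + quadrantSquare d)) := by
  left
  rw [Finset.card_eq_zero, Finset.filter_eq_empty_iff]
  intro d _ h
  have h1 := sameParity_chairSubst (y (blockIndex (v + quadrantSquare d)))
    (blockCorner (v + quadrantSquare d))
  have h2 := blockCorner_parity (v + quadrantSquare d)
  simp only [inflate] at h
  rw [h] at h1
  have h3 : ((d + 2 : Fin 4) : ℕ) % 2 = (d : ℕ) % 2 := sameParity_add_two d
  have h4 : (quadrantSquare d 0 + quadrantSquare d 1) % 2 = (d : ℕ) % 2 := by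
    fin_cases d <;> simp [quadrantSquare]
  unfold SameParity at h1
  simp only [Pi.add_apply] at h2
  omega

theorem vertex_cases (v : Fin 2 → ℤ) :
    (v 0 + v 1) % 2 = 1 ∨ (∃ l, v = (2 : ℤ) • l) ∨ ∃ l, v = (2 : ℤ) • l + 1 := by
  rcases Int.emod_two_eq_zero_or_one (v 0) with h0 | h0 <;>
    rcases Int.emod_two_eq_zero_or_one (v 1) with h1 | h1
  · exact Or.inr (Or.inl (exists_eq_two_smul (Fin.forall_fin_two.2 ⟨h0, h1⟩)))
  · left; omega
  · left; omega
  · obtain ⟨l, hl⟩ := exists_eq_two_smul (r := v - 1)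
      (Fin.forall_fin_two.2 ⟨by simp; omega, by simp; omega⟩)
    exact Or.inr (Or.inr ⟨l, by rw [← hl]; simp⟩)

theorem legalVertex_chairFix (v : Fin 2 → ℤ) :
    LegalVertex (fun d => chairFix (v + quadrantSquare d)) := by
  induction hN : (v 0).natAbs + (v 1).natAbs using Nat.strong_induction_on generalizing v with
  | _ N ih =>
    rcases vertex_cases v with h | ⟨l, rfl⟩ | ⟨l, rfl⟩
    · rw [← inflate_chairFix]; exact legalVertex_inflate_mixed _ h
    · by_cases h0 : l 0 = 0 ∧ l 1 = 0
      · obtain rfl : l = 0 := by funext i; fin_cases i <;> simp [h0]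
        simp only [smul_zero, zero_add, chairFix_quadrantSquare]
        left; decide
      · rw [← inflate_chairFix, legalVertex_inflate_even]
        refine ih _ ?_ l rfl
        simp only [Pi.smul_apply, smul_eq_mul] at hN
        omega
    · rw [← inflate_chairFix]; exact legalVertex_inflate_odd _ l

theorem legalVertex_of_mem {y : (Fin 2 → ℤ) → Fin 4} (hy : y ∈ chairShift.carrier)
    (v : Fin 2 → ℤ) : LegalVertex (fun d => y (v + quadrantSquare d)) := by
  refine chairShift_induction
    (P := (fun y : (Fin 2 → ℤ) → Fin 4 => fun d => y (v + quadrantSquare d)) ⁻¹'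
      {u | LegalVertex u})
    (IsClosed.preimage (continuous_pi fun d => continuous_apply _) (isClosed_discrete _))
    (fun k => ?_) hy
  have := legalVertex_chairFix (v + k)
  simpa only [Set.mem_preimage, Set.mem_ofPred_eq, translateConfig, add_right_comm v k] using this

/-! ### The five points of phase zero -/

/-- The point has phase `0` at all levels. -/
def ZeroPhase (y : (Fin 2 → ℤ) → Fin 4) : Prop := ∀ n, HasPhase n 0 y

theorem ZeroPhase.mem {y : (Fin 2 → ℤ) → Fin 4} (h : ZeroPhase y) : y ∈ chairShift.carrier :=
  (h 0).mem

theorem inflate_iterate_chairFix (n : ℕ) : inflate^[n] chairFix = chairFix :=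
  Function.iterate_fixed inflate_chairFix n

theorem zeroPhase_chairFix : ZeroPhase chairFix := fun n =>
  ⟨chairFix, chairFix_mem, by rw [translateConfig_zero, inflate_iterate_chairFix]⟩

/-- The `j`-th square on the diagonal of the quadrant `d`, counted from the origin. -/
def ray (d : Fin 4) (j : ℕ) : Fin 2 → ℤ := quadrantSquare d + (j : ℤ) • diagDir d

theorem ray_zero (d : Fin 4) : ray d 0 = quadrantSquare d := by simp [ray]

theorem blockIndex_iterate_ray {n j : ℕ} (hj : j < 2 ^ n) (d : Fin 4) :
    blockIndex^[n] (ray d j) = quadrantSquare d := by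
  have hj' : (j : ℤ) < 2 ^ n := by exact_mod_cast hj
  have e1 : (j : ℤ) / 2 ^ n = 0 := Int.ediv_eq_zero_of_lt (by positivity) hj'
  have e2 : (-1 - (j : ℤ)) / 2 ^ n = -1 := by
    rw [Int.ediv_eq_iff_of_pos (by positivity)]; lia
  have e3 : (-1 + -(j : ℤ)) / 2 ^ n = -1 := e2
  funext i
  rw [blockIndex_iterate_apply]
  fin_cases d <;> fin_cases i <;> simp [ray, quadrantSquare, diagDir, e1, e3]

theorem onDiagonal_ray (n j : ℕ) {a d : Fin 4} (h : SameParity a d) :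
    OnDiagonal n a (ray d j) := by
  unfold SameParity at h
  unfold OnDiagonal
  rw [h]
  fin_cases d <;> simp [ray, quadrantSquare, diagDir]

theorem blockCorner_quadrantSquare (d : Fin 4) : blockCorner (quadrantSquare d) = d + 2 := by
  revert d; decide

theorem ZeroPhase.sameParity {y : (Fin 2 → ℤ) → Fin 4} (h : ZeroPhase y) (d : Fin 4) :
    SameParity (y (quadrantSquare d)) d := by
  obtain ⟨w, -, hw⟩ := h 1
  rw [hw, translateConfig_zero, Function.iterate_one, inflate, blockCorner_quadrantSquare]
  exact (sameParity_chairSubst _ _).trans (sameParity_add_two d)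

theorem ZeroPhase.ne_ray {y y' : (Fin 2 → ℤ) → Fin 4} (h : ZeroPhase y) (h' : ZeroPhase y')
    {d : Fin 4} (hne : y (quadrantSquare d) ≠ y' (quadrantSquare d)) (j : ℕ) :
    y (ray d j) ≠ y' (ray d j) := by
  have hj : j < 2 ^ j := Nat.lt_two_pow_self
  have := ((h (j + 1)).diagonal_of_ne (h' (j + 1)) hne).2 (ray d j)
    (by rw [add_zero, add_zero, blockIndex_iterate_ray hj, ← ray_zero d,
      blockIndex_iterate_ray (Nat.two_pow_pos j), ray_zero])
    (by rw [add_zero]; exact onDiagonal_ray _ _ (h.sameParity d))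
  rw [this.1, this.2]
  exact hne

/-- Two points of phase zero can differ on the four diagonal rays at the origin only. -/
theorem ZeroPhase.exists_ray_of_ne {y y' : (Fin 2 → ℤ) → Fin 4} (h : ZeroPhase y)
    (h' : ZeroPhase y') {k : Fin 2 → ℤ} (hne : y k ≠ y' k) :
    ∃ d j, k = ray d j ∧ y (quadrantSquare d) ≠ y' (quadrantSquare d) := by
  -- at this level the block of `k` touches the origin and the diagonals of two adjacent
  -- quadrants cannot meet `k`
  obtain ⟨n, hn⟩ : ∃ n : ℕ, (k 0).natAbs + (k 1).natAbs + 2 < 2 ^ n :=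
    ⟨_, Nat.lt_two_pow_self⟩
  have hn' : |k 0| + |k 1| + 2 < 2 ^ n := by
    have : (((k 0).natAbs + (k 1).natAbs + 2 : ℕ) : ℤ) < ((2 ^ n : ℕ) : ℤ) := by exact_mod_cast hn
    push_cast at this
    exact this
  obtain ⟨h1, h2⟩ := (h (n + 1)).diagonal_of_ne (h' (n + 1)) hne
  rw [add_zero] at h1
  have hdvd : ∀ t : ℤ, (2 ^ n : ℤ) ∣ t → |t| ≤ |k 0| + |k 1| + 1 → t = 0 := fun t ht hle =>
    Int.eq_zero_of_abs_lt_dvd ht (by linarith)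
  have hb0 := abs_cases (k 0)
  have hb1 := abs_cases (k 1)
  obtain ⟨d, j, hk, hpar, hj⟩ : ∃ d j, k = ray d j ∧ SameParity (y k) d ∧ j < 2 ^ n := by
    unfold OnDiagonal at h1
    split_ifs at h1 with hpar
    · have := hdvd _ h1 (by rw [abs_le]; omega)
      by_cases h0 : 0 ≤ k 0
      · refine ⟨0, (k 0).toNat, ?_, ?_, by zify; omega⟩
        · funext i; fin_cases i <;> simp [ray, quadrantSquare, diagDir] <;> omega
        · unfold SameParity; simp; omega
      · refine ⟨2, (-1 - k 0).toNat, ?_, ?_, by zify; omega⟩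
        · funext i; fin_cases i <;> simp [ray, quadrantSquare, diagDir] <;> omega
        · unfold SameParity; simp; omega
    · have := hdvd _ h1 (by rw [abs_le]; omega)
      by_cases h0 : 0 ≤ k 0
      · refine ⟨1, (k 0).toNat, ?_, ?_, by zify; omega⟩
        · funext i; fin_cases i <;> simp [ray, quadrantSquare, diagDir] <;> omega
        · unfold SameParity; simp; omega
      · refine ⟨3, (-1 - k 0).toNat, ?_, ?_, by zify; omega⟩
        · funext i; fin_cases i <;> simp [ray, quadrantSquare, diagDir] <;> omega
        · unfold SameParity; simp; omega
  refine ⟨d, j, hk, ?_⟩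
  subst hk
  have hb : blockIndex^[n] (quadrantSquare d) = quadrantSquare d := by
    rw [← ray_zero, blockIndex_iterate_ray (Nat.two_pow_pos n), ray_zero]
  have := h2 (quadrantSquare d) (by rw [add_zero, add_zero, hb, blockIndex_iterate_ray hj])
    (by rw [add_zero, ← ray_zero]; exact onDiagonal_ray _ _ hpar)
  rwa [this.1, this.2]

theorem isClosed_hasPhase (n : ℕ) (z : Fin 2 → ℤ) : IsClosed {y | HasPhase n z y} := by
  have : {y | HasPhase n z y} =
      (fun w => translateConfig z (inflate^[n] w)) '' chairShift.carrier := by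
    ext y
    exact ⟨fun ⟨w, hw, h⟩ => ⟨w, hw, h.symm⟩, fun ⟨w, hw, h⟩ => ⟨w, hw, h.symm⟩⟩
  rw [this]
  exact (isCompact_chairShift.image
    ((continuous_translateConfig z).comp (continuous_inflate.iterate n))).isClosed

/-- For every `a` there is a point of phase zero whose origin is the reflex corner of a chair with
missing square in the direction `a`. -/
theorem exists_reflexPoint (a : Fin 4) :
    ∃ y, ZeroPhase y ∧ ∀ d, y (quadrantSquare d) = if d = a then d else d + 2 := by
  let t : ℕ → Set ((Fin 2 → ℤ) → Fin 4) := fun n =>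
    {y | HasPhase n 0 y} ∩ ⋂ d : Fin 4, {y | y (quadrantSquare d) = if d = a then d else d + 2}
  have hclosed : ∀ n, IsClosed (t n) := fun n =>
    (isClosed_hasPhase n 0).inter (isClosed_iInter fun d =>
      isClosed_eq (continuous_apply _) continuous_const)
  have hne : ∀ n, (t n).Nonempty := fun n => by
    -- start from the reflex corner inside the block of a square with letter `a`
    let y₀ := translateConfig ((2 : ℤ) • quadrantSquare a + 1) chairFix
    have hy₀ : ∀ d, y₀ (quadrantSquare d) = if d = a then d else d + 2 := fun d => by
      simp only [y₀, translateConfig]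
      rw [← inflate_chairFix, inflate, add_comm, (blockIndex_blockCorner_vertex_odd _ d).1,
        (blockIndex_blockCorner_vertex_odd _ d).2, chairFix_quadrantSquare]
      rfl
    refine ⟨inflate^[n] y₀, ⟨y₀, translate_chairFix_mem _, (translateConfig_zero _).symm⟩,
      Set.mem_iInter.2 fun d => ?_⟩
    have hb : blockIndex^[n] (quadrantSquare d) = quadrantSquare d := by
      rw [← ray_zero, blockIndex_iterate_ray (Nat.two_pow_pos n), ray_zero]
    have hd : OnDiagonal n (y₀ (blockIndex^[n] (quadrantSquare d))) (quadrantSquare d) := by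
      rw [hb, ← ray_zero]
      apply onDiagonal_ray
      rw [ray_zero, hy₀]
      split_ifs
      exacts [rfl, sameParity_add_two d]
    rw [Set.mem_ofPred_eq, inflate_iterate_of_onDiagonal hd, hb, hy₀]
  obtain ⟨y, hy⟩ := IsCompact.nonempty_iInter_of_sequence_nonempty_isCompact_isClosed t
    (fun n y hy => ⟨hy.1.of_succ, hy.2⟩) hne (hclosed 0).isCompact hclosed
  rw [Set.mem_iInter] at hy
  exact ⟨y, fun n => (hy n).1, fun d => Set.mem_iInter.1 (hy 0).2 d⟩

/-! ### Faithfulness and the orbit of the inflation tiling -/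

instance : CompactSpace chairShift.Pt := isCompact_iff_compactSpace.1 isCompact_chairShift

theorem eq_zero_of_two_pow_dvd {t : ℤ} (h : ∀ n : ℕ, (2 ^ n : ℤ) ∣ t) : t = 0 := by
  refine Int.eq_zero_of_abs_lt_dvd (h t.natAbs) ?_
  rw [Int.abs_eq_natAbs]
  exact_mod_cast Nat.lt_two_pow_self

theorem HasPhase.eq_of_forall {y : (Fin 2 → ℤ) → Fin 4} {k l : Fin 2 → ℤ}
    (h : ∀ n, HasPhase n k y) (h' : ∀ n, HasPhase n l y) : k = l := by
  funext i
  exact sub_eq_zero.1 (eq_zero_of_two_pow_dvd fun n => (h n).unique (h' n) i)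

/-- The inflation tiling as a point of the shift space. -/
noncomputable def chairPt : chairShift.Pt := ⟨chairFix, chairFix_mem⟩

theorem S_injective : Function.Injective chairShift.S := by
  intro k l h
  have h1 : translateConfig k chairFix = translateConfig l chairFix :=
    congrArg Subtype.val (congrArg (fun H : chairShift.Pt ≃ₜ chairShift.Pt => H chairPt) h)
  refine HasPhase.eq_of_forall (y := translateConfig k chairFix) (fun n => ?_) (fun n => ?_)
  · simpa using (zeroPhase_chairFix n).translate k
  · rw [h1]; simpa using (zeroPhase_chairFix n).translate l

theorem chairShift_isFaithful : chairShift.IsFaithful := fun _ _ h => S_injective h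

theorem dense_orbit_chairPt : DenseRange fun k => chairShift.S k chairPt := by
  intro y
  rw [closure_subtype, ← Set.range_comp]
  exact y.2

theorem S_add (k l : Fin 2 → ℤ) : chairShift.S (k + l) = chairShift.S k * chairShift.S l :=
  chairShift.action.map_mul (Multiplicative.ofAdd k) (Multiplicative.ofAdd l)

theorem S_zero : chairShift.S 0 = 1 := chairShift.action.map_one

theorem S_apply_apply (k l : Fin 2 → ℤ) (y : chairShift.Pt) :
    chairShift.S k (chairShift.S l y) = chairShift.S (k + l) y := by
  rw [S_add]; rfl

theorem S_mem_shiftGroup (k : Fin 2 → ℤ) : chairShift.S k ∈ chairShift.shiftGroup :=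
  ⟨Multiplicative.ofAdd k, rfl⟩

theorem mem_shiftGroup_iff {H : chairShift.Pt ≃ₜ chairShift.Pt} :
    H ∈ chairShift.shiftGroup ↔ ∃ k, chairShift.S k = H :=
  ⟨fun ⟨k, hk⟩ => ⟨k.toAdd, hk⟩, fun ⟨k, hk⟩ => ⟨Multiplicative.ofAdd k, hk⟩⟩

/-! ### Locality of homeomorphisms -/

/-- A continuous self-map of the shift space reads its value at the origin from a finite window. -/
theorem exists_window {H : chairShift.Pt → chairShift.Pt} (hH : Continuous H) :
    ∃ C : ℕ, ∀ y y' : chairShift.Pt, (∀ j : Fin 2 → ℤ, (∀ i, |j i| ≤ C) → y.1 j = y'.1 j) →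
      (H y).1 0 = (H y').1 0 := by
  by_contra! hcon
  choose y y' hy hne using hcon
  obtain ⟨a, φ, hφ, ha⟩ := CompactSpace.tendsto_subseq y
  have hcoord : ∀ {u : ℕ → chairShift.Pt}, Filter.Tendsto u Filter.atTop (nhds a) →
      ∀ j, ∀ᶠ n in Filter.atTop, (u n).1 j = a.1 j := fun hu j => by
    have := ((continuous_apply j).comp continuous_subtype_val).continuousAt.tendsto.comp hu
    rw [nhds_discrete] at this
    simpa using this
  have ha' : Filter.Tendsto (y' ∘ φ) Filter.atTop (nhds a) := by
    rw [tendsto_subtype_rng, tendsto_pi_nhds]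
    intro j
    refine tendsto_nhds_of_eventually_eq ?_
    obtain ⟨B, hB⟩ : ∃ B : ℕ, ∀ i, |j i| ≤ B :=
      ⟨(j 0).natAbs + (j 1).natAbs, by rw [Fin.forall_fin_two]; push_cast; constructor <;> simp⟩
    filter_upwards [hcoord ha j, Filter.eventually_ge_atTop B] with n h1 h2
    rw [← h1]
    exact (hy (φ n) j fun i => (hB i).trans (by exact_mod_cast h2.trans (hφ.id_le n))).symm
  have key : ∀ {u : ℕ → chairShift.Pt}, Filter.Tendsto u Filter.atTop (nhds a) →
      ∀ᶠ n in Filter.atTop, (H (u n)).1 0 = (H a).1 0 := fun hu => by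
    have := (((continuous_apply 0).comp continuous_subtype_val).comp
      hH).continuousAt.tendsto.comp hu
    rw [nhds_discrete] at this
    simpa using this
  obtain ⟨n, h1, h2⟩ := ((key ha).and (key ha')).exists
  exact hne (φ n) (h1.trans h2.symm)

/-- The homeomorphism `H` conjugates `S^k` to `S^(M k)`. -/
def Intertwines (H : chairShift.Pt ≃ₜ chairShift.Pt) (M : (Fin 2 → ℤ) ≃+ (Fin 2 → ℤ)) : Prop :=
  ∀ k y, H (chairShift.S k y) = chairShift.S (M k) (H y)

theorem intertwines_iff {H : chairShift.Pt ≃ₜ chairShift.Pt} {M : (Fin 2 → ℤ) ≃+ (Fin 2 → ℤ)} :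
    Intertwines H M ↔ ∀ k, H * chairShift.S k * H⁻¹ = chairShift.S (M k) := by
  simp only [mul_inv_eq_iff_eq_mul]
  exact forall_congr' fun k => ⟨fun h => Homeomorph.ext h, fun h y => congrArg (· y) h⟩

theorem Intertwines.symm {H : chairShift.Pt ≃ₜ chairShift.Pt} {M : (Fin 2 → ℤ) ≃+ (Fin 2 → ℤ)}
    (h : Intertwines H M) : Intertwines H.symm M.symm := by
  intro k y
  rw [Homeomorph.symm_apply_eq, h]
  simp

/-- An extended symmetry acts on the shift group by an automorphism of `ℤ²`. -/
theorem exists_intertwines {H : chairShift.Pt ≃ₜ chairShift.Pt}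
    (hH : H ∈ chairShift.extendedSymmetryGroup) : ∃ M, Intertwines H M := by
  have hmap : ∀ {H}, H ∈ chairShift.extendedSymmetryGroup →
      ∀ k, ∃ l, chairShift.S l = H * chairShift.S k * H⁻¹ := fun hH k =>
    mem_shiftGroup_iff.1 ((Subgroup.mem_normalizer_iff.1 hH _).1 (S_mem_shiftGroup k))
  choose M hM using hmap hH
  choose N hN using hmap (inv_mem hH)
  refine ⟨{ toFun := M, invFun := N, left_inv := fun k => S_injective ?_,
            right_inv := fun k => S_injective ?_, map_add' := fun k l => S_injective ?_ },
    intertwines_iff.2 fun k => (hM k).symm⟩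
  · rw [hN, hM]; group
  · rw [hM, hN]; group
  · rw [hM, S_add, S_add, hM, hM]; group

/-- The places where two points differ move under `H` along its matrix, up to a bounded error. -/
theorem Intertwines.exists_near {H : chairShift.Pt ≃ₜ chairShift.Pt}
    {M : (Fin 2 → ℤ) ≃+ (Fin 2 → ℤ)} (h : Intertwines H M) :
    ∃ C : ℕ, ∀ (y y' : chairShift.Pt) (p : Fin 2 → ℤ), (H y).1 p ≠ (H y').1 p →
      ∃ j : Fin 2 → ℤ, (∀ i, |j i| ≤ C) ∧ y.1 (M.symm p + j) ≠ y'.1 (M.symm p + j) := by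
  obtain ⟨C, hC⟩ := exists_window H.continuous
  refine ⟨C, fun y y' p hne => ?_⟩
  by_contra! hcon
  have := hC (chairShift.S (M.symm p) y) (chairShift.S (M.symm p) y') fun j hj => by
    have := hcon j hj
    rwa [add_comm] at this
  rw [h, h, M.apply_symm_apply] at this
  apply hne
  simpa [ZdShift.S, translateConfig] using this

/-! ### Pairs of points that differ near a line -/

/-- Configurations that differ only near a line agree on large boxes: go far away in the normal
direction of the line. -/
theorem agreeOnBoxes_of_strip {y y' : (Fin 2 → ℤ) → Fin 4} {α β B : ℤ} (h0 : α ≠ 0 ∨ β ≠ 0)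
    (h : ∀ k, y k ≠ y' k → |α * k 0 + β * k 1| ≤ B) : AgreeOnBoxes y y' := by
  intro N
  set T : ℤ := |B| + 1 + N * (|α| + |β|) with hT
  refine ⟨![T * α, T * β], fun k hk => ?_⟩
  by_contra hne
  have h1 := (abs_le.1 (h k hne)).2
  have k0 := hk 0
  have k1 := hk 1
  simp only [Matrix.cons_val_zero, Matrix.cons_val_one] at k0 k1
  obtain ⟨u, hu⟩ : ∃ u, u = k 0 - T * α := ⟨_, rfl⟩
  obtain ⟨v, hv⟩ : ∃ v, v = k 1 - T * β := ⟨_, rfl⟩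
  have e : α * k 0 + β * k 1 = T * (α ^ 2 + β ^ 2) + (α * u + β * v) := by rw [hu, hv]; ring
  have h2 : 1 ≤ α ^ 2 + β ^ 2 := by
    rcases h0 with h0 | h0
    · have := Int.one_le_abs h0; nlinarith [sq_abs α, sq_nonneg β]
    · have := Int.one_le_abs h0; nlinarith [sq_abs β, sq_nonneg α]
  have hTpos : 0 ≤ T := by positivity
  have h3 : -(N * |α|) ≤ α * u := by
    have : |α * u| ≤ |α| * N := by
      rw [abs_mul]; exact mul_le_mul_of_nonneg_left (by rw [abs_le]; omega) (abs_nonneg _)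
    linarith [(abs_le.1 this).1, mul_comm |α| (N : ℤ)]
  have h4 : -(N * |β|) ≤ β * v := by
    have : |β * v| ≤ |β| * N := by
      rw [abs_mul]; exact mul_le_mul_of_nonneg_left (by rw [abs_le]; omega) (abs_nonneg _)
    linarith [(abs_le.1 this).1, mul_comm |β| (N : ℤ)]
  have h5 : T ≤ T * (α ^ 2 + β ^ 2) := le_mul_of_one_le_right hTpos h2
  have := le_abs_self B
  linarith [mul_add (N : ℤ) |α| |β|]

/-- Two points of the shift space that differ, but only near a line, differ at a letter whose
diagonal is parallel to this line. -/
theorem exists_ne_of_strip {y y' : (Fin 2 → ℤ) → Fin 4} (hy : y ∈ chairShift.carrier)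
    (hy' : y' ∈ chairShift.carrier) (hne : y ≠ y') {α β B : ℤ} (h0 : α ≠ 0 ∨ β ≠ 0)
    (h : ∀ k, y k ≠ y' k → |α * k 0 + β * k 1| ≤ B) :
    ∃ k, y k ≠ y' k ∧ α * letterLine (y k) 0 + β * letterLine (y k) 1 = 0 := by
  obtain ⟨k, hk⟩ := Function.ne_iff.1 hne
  refine ⟨k, hk, ?_⟩
  have hph := (agreeOnBoxes_of_strip h0 h).samePhases hy hy'
  have hB : 0 ≤ B := (abs_nonneg _).trans (h k hk)
  obtain ⟨n, hn⟩ : ∃ n : ℕ, 2 * B + 1 < 2 ^ n := by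
    obtain ⟨n, hn⟩ := pow_unbounded_of_one_lt (2 * B + 1) (one_lt_two (α := ℤ))
    exact ⟨n, hn⟩
  obtain ⟨m, hm⟩ := hph.exists_segment hk n
  set v := letterLine (y k)
  by_contra hc
  have h1 := abs_le.1 (h _ (hm 0 le_rfl (by positivity)))
  have h2 := abs_le.1 (h _ (hm (2 * B + 1) (by linarith) hn))
  simp only [Pi.add_apply, Pi.smul_apply, smul_eq_mul] at h1 h2
  have h3 := Int.one_le_abs hc
  rcases abs_cases (α * v 0 + β * v 1) with h4 | h4 <;> nlinarith

/-- For each of the two diagonal directions there is a pair of different points of phase zero that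
differ only near the line through the origin in this direction. -/
theorem exists_line_pair (s : ℤ) (hs : s = 1 ∨ s = -1) : ∃ y y' : chairShift.Pt,
    ZeroPhase y.1 ∧ ZeroPhase y'.1 ∧ y ≠ y' ∧ ∀ k, y.1 k ≠ y'.1 k → |k 0 - s * k 1| ≤ 1 := by
  suffices H : ∀ a : Fin 4, (∀ d j, (d = a ∨ d = a + 2) → |ray d j 0 - s * ray d j 1| ≤ 1) →
      ∃ y y' : chairShift.Pt, ZeroPhase y.1 ∧ ZeroPhase y'.1 ∧ y ≠ y' ∧
        ∀ k, y.1 k ≠ y'.1 k → |k 0 - s * k 1| ≤ 1 by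
    rcases hs with rfl | rfl
    · refine H 0 fun d j hd => ?_
      rcases hd with rfl | rfl <;> simp [ray, quadrantSquare, diagDir]
    · refine H 1 fun d j hd => ?_
      rcases hd with rfl | rfl <;> simp [ray, quadrantSquare, diagDir]
  intro a ha
  obtain ⟨y, hy, hya⟩ := exists_reflexPoint a
  obtain ⟨y', hy', hya'⟩ := exists_reflexPoint (a + 2)
  refine ⟨⟨y, hy.mem⟩, ⟨y', hy'.mem⟩, hy, hy', fun h => ?_, fun k hk => ?_⟩
  · have := congrFun (congrArg Subtype.val h) (quadrantSquare a)
    simp only [hya, hya'] at this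
    clear hya hya' ha
    revert this; revert a; decide
  · obtain ⟨d, j, rfl, hd⟩ := hy.exists_ray_of_ne hy' hk
    refine ha d j ?_
    rw [hya, hya'] at hd
    clear hya hya' ha hk
    revert hd; revert a d; decide

/-! ### Extended symmetries act by signed permutations -/

theorem map_eq_smul_add_smul (M : (Fin 2 → ℤ) ≃+ (Fin 2 → ℤ)) (p : Fin 2 → ℤ) :
    M p = p 0 • M (Pi.single 0 1) + p 1 • M (Pi.single 1 1) := by
  rw [← map_zsmul, ← map_zsmul, ← map_add]
  congr 1
  funext i; fin_cases i <;> simp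

/-- The matrix of an extended symmetry maps diagonal directions to diagonal directions. -/
theorem Intertwines.map_diagonal {H : chairShift.Pt ≃ₜ chairShift.Pt}
    {M : (Fin 2 → ℤ) ≃+ (Fin 2 → ℤ)} (h : Intertwines H M) (s : ℤ) (hs : s = 1 ∨ s = -1) :
    ∃ c t : ℤ, (c = 1 ∨ c = -1) ∧ (t = 1 ∨ t = -1) ∧ M ![s, 1] = c • ![1, t] := by
  obtain ⟨y, y', -, -, hne, hline⟩ := exists_line_pair s hs
  obtain ⟨C, hC⟩ := h.exists_near
  -- the linear form that vanishes on the image of the line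
  set α : ℤ := M.symm (Pi.single 0 1) 0 - s * M.symm (Pi.single 0 1) 1
  set β : ℤ := M.symm (Pi.single 1 1) 0 - s * M.symm (Pi.single 1 1) 1
  have hform : ∀ p, M.symm p 0 - s * M.symm p 1 = α * p 0 + β * p 1 := fun p => by
    rw [map_eq_smul_add_smul M.symm p]
    simp only [Pi.add_apply, Pi.smul_apply, smul_eq_mul, α, β]
    ring
  have h0 : α ≠ 0 ∨ β ≠ 0 := by
    by_contra! hcon
    have := hform (M (Pi.single 0 1))
    rw [hcon.1, hcon.2, M.symm_apply_apply] at this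
    simp at this
  obtain ⟨k, -, hk⟩ := exists_ne_of_strip (B := 2 * C + 1) (H y).2 (H y').2
    (fun e => hne (H.injective (Subtype.ext e))) h0 fun p hp => by
      obtain ⟨j, hj, hj'⟩ := hC y y' p hp
      have h1 := abs_le.1 (hline _ hj')
      have h2 := abs_le.1 (hj 0)
      have h3 := abs_le.1 (hj 1)
      simp only [Pi.add_apply] at h1
      rw [← hform, abs_le]
      rcases hs with rfl | rfl <;> constructor <;> linarith
  obtain ⟨t, ht, hv⟩ : ∃ t : ℤ, (t = 1 ∨ t = -1) ∧ letterLine ((H y).1 k) = ![1, t] := by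
    unfold letterLine
    split_ifs
    · exact ⟨1, Or.inl rfl, rfl⟩
    · exact ⟨-1, Or.inr rfl, rfl⟩
  rw [hv, ← hform] at hk
  set c := M.symm ![1, t] 1 with hc
  have e : M.symm ![1, t] = c • ![s, 1] := by
    funext i; fin_cases i
    · simp; linarith
    · simp [hc]
  have e2 : ![1, t] = c • M ![s, 1] := by
    rw [← map_zsmul, ← e, M.apply_symm_apply]
  have hc1 : c = 1 ∨ c = -1 := by
    have := congrFun e2 0
    simp only [Matrix.cons_val_zero, Pi.smul_apply, smul_eq_mul] at this
    exact Int.isUnit_iff.1 (IsUnit.of_mul_eq_one _ this.symm)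
  refine ⟨c, t, hc1, ht, ?_⟩
  rw [e2, smul_smul]
  rcases hc1 with h1 | h1 <;> simp [h1]

/-- The matrix of an extended symmetry is a signed permutation: the basis vectors are half sums and
half differences of diagonal directions. -/
theorem Intertwines.exists_signedPerm {H : chairShift.Pt ≃ₜ chairShift.Pt}
    {M : (Fin 2 → ℤ) ≃+ (Fin 2 → ℤ)} (h : Intertwines H M) :
    ∃ (π : Equiv.Perm (Fin 2)) (ε : Fin 2 → ℤˣ),
      ∀ i, M (Pi.single i 1) = (ε i : ℤ) • Pi.single (π i) 1 := by
  obtain ⟨c, t, hc, ht, h1⟩ := h.map_diagonal 1 (Or.inl rfl)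
  obtain ⟨c', t', hc', ht', h2⟩ := h.map_diagonal (-1) (Or.inr rfl)
  rw [map_eq_smul_add_smul] at h1 h2
  have hinj : M (Pi.single 0 1) ≠ 0 ∧ M (Pi.single 1 1) ≠ 0 := by
    constructor <;> rw [Ne, map_eq_zero_iff M M.injective] <;> simp
  generalize hU : M (Pi.single 0 1) = u at h1 h2 hinj
  generalize hV : M (Pi.single 1 1) = v at h1 h2 hinj
  have h10 := congrFun h1 0
  have h11 := congrFun h1 1
  have h20 := congrFun h2 0
  have h21 := congrFun h2 1
  simp at h10 h11 h20 h21
  have hu : u 0 ≠ 0 ∨ u 1 ≠ 0 := by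
    by_contra! hcon; exact hinj.1 (by funext i; fin_cases i <;> simp [hcon])
  have hv : v 0 ≠ 0 ∨ v 1 ≠ 0 := by
    by_contra! hcon; exact hinj.2 (by funext i; fin_cases i <;> simp [hcon])
  have hcase : (u 0 = 0 ∧ v 1 = 0 ∧ (u 1 = 1 ∨ u 1 = -1) ∧ (v 0 = 1 ∨ v 0 = -1)) ∨
      (u 1 = 0 ∧ v 0 = 0 ∧ (u 0 = 1 ∨ u 0 = -1) ∧ (v 1 = 1 ∨ v 1 = -1)) := by
    rcases hc with rfl | rfl <;> rcases hc' with rfl | rfl <;> rcases ht with rfl | rfl <;>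
      rcases ht' with rfl | rfl <;> omega
  have hunit : ∀ {t : ℤ}, t = 1 ∨ t = -1 → ∃ e : ℤˣ, (e : ℤ) = t := fun ht =>
    (Int.isUnit_iff.2 ht)
  rcases hcase with ⟨hu0, hv1, hu1, hv0⟩ | ⟨hu1, hv0, hu0, hv1⟩
  · obtain ⟨e, he⟩ := hunit hu1
    obtain ⟨f, hf⟩ := hunit hv0
    refine ⟨Equiv.swap 0 1, ![e, f], Fin.forall_fin_two.2 ⟨?_, ?_⟩⟩ <;> funext i <;>
      fin_cases i <;> simp [*]
  · obtain ⟨e, he⟩ := hunit hu0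
    obtain ⟨f, hf⟩ := hunit hv1
    refine ⟨1, ![e, f], Fin.forall_fin_two.2 ⟨?_, ?_⟩⟩ <;> funext i <;> fin_cases i <;> simp [*]

theorem S_zsmul (m : ℤ) (k : Fin 2 → ℤ) : chairShift.S (m • k) = chairShift.S k ^ m :=
  map_zpow chairShift.action (Multiplicative.ofAdd k) m

theorem chairShift_isHypercubic : chairShift.IsHypercubic := by
  intro H hH
  obtain ⟨M, hM⟩ := exists_intertwines hH
  obtain ⟨π, ε, h⟩ := hM.exists_signedPerm
  exact ⟨π, ε, fun i => by rw [intertwines_iff.1 hM, h, S_zsmul]⟩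

/-! ### The symmetry group -/

theorem ray_near {d d' : Fin 4} {j j' C : ℕ} {e : Fin 2 → ℤ} (he : ∀ i, |e i| ≤ C) (hj : C < j)
    (h : ray d j + e = ray d' j') : d = d' := by
  have h0 := congrFun h 0
  have h1 := congrFun h 1
  have e0 := abs_le.1 (he 0)
  have e1 := abs_le.1 (he 1)
  simp only [ray, Pi.add_apply, Pi.smul_apply, smul_eq_mul] at h0 h1
  revert h0 h1
  fin_cases d <;> fin_cases d' <;> simp [quadrantSquare, diagDir] <;> omega

/-- A homeomorphism that commutes with the shifts preserves agreement of points of phase zero in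
each quadrant. -/
theorem Intertwines.eq_quadrant {Φ : chairShift.Pt ≃ₜ chairShift.Pt}
    (h : Intertwines Φ (AddEquiv.refl _)) {y y' : chairShift.Pt} (hy : ZeroPhase y.1)
    (hy' : ZeroPhase y'.1) (hΦ : ZeroPhase (Φ y).1) (hΦ' : ZeroPhase (Φ y').1) {d : Fin 4}
    (hd : y.1 (quadrantSquare d) = y'.1 (quadrantSquare d)) :
    (Φ y).1 (quadrantSquare d) = (Φ y').1 (quadrantSquare d) := by
  by_contra hne
  obtain ⟨C, hC⟩ := h.exists_near
  obtain ⟨e, he, he'⟩ := hC y y' (ray d (C + 1)) (hΦ.ne_ray hΦ' hne (C + 1))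
  obtain ⟨d', j', h1, h2⟩ := hy.exists_ray_of_ne hy' he'
  obtain rfl := ray_near he (Nat.lt_succ_self C) h1
  exact h2 hd

/-- The images of two points of phase zero under a homeomorphism that commutes with the shifts have
the same phases. -/
theorem Intertwines.samePhases {Φ : chairShift.Pt ≃ₜ chairShift.Pt}
    (h : Intertwines Φ (AddEquiv.refl _)) {y y' : chairShift.Pt} (hy : ZeroPhase y.1)
    (hy' : ZeroPhase y'.1) : SamePhases (Φ y).1 (Φ y').1 := by
  refine AgreeOnBoxes.samePhases (fun N => ?_) (Φ y).2 (Φ y').2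
  obtain ⟨C, hC⟩ := h.exists_near
  -- a box in the first coordinate direction, far away from both diagonals
  refine ⟨![2 * C + N + 2, 0], fun k hk => ?_⟩
  by_contra hne
  obtain ⟨e, he, he'⟩ := hC y y' k hne
  obtain ⟨d, j, h1, -⟩ := hy.exists_ray_of_ne hy' he'
  have k0 := hk 0
  have k1 := hk 1
  have h0 := congrFun h1 0
  have h1 := congrFun h1 1
  have e0 := abs_le.1 (he 0)
  have e1 := abs_le.1 (he 1)
  simp only [ray, Pi.add_apply, Pi.smul_apply, smul_eq_mul, Matrix.cons_val_zero,
    Matrix.cons_val_one, AddEquiv.refl_symm, AddEquiv.refl_apply] at h0 h1 k0 k1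
  revert h0 h1
  fin_cases d <;> simp [quadrantSquare, diagDir] <;> omega

/-- The image of the inflation tiling under a homeomorphism that commutes with the shifts has an
integer vector as its phase at all levels: it differs from companions along both a diagonal and an
antidiagonal, and these two lines determine the phase. -/
theorem Intertwines.exists_phase {Φ : chairShift.Pt ≃ₜ chairShift.Pt}
    (h : Intertwines Φ (AddEquiv.refl _)) : ∃ m, ∀ n, HasPhase n m (Φ chairPt).1 := by
  have hline : ∀ s : ℤ, (s = 1 ∨ s = -1) → ∃ (k : Fin 2 → ℤ) (a : Fin 4),
      letterLine a 0 - s * letterLine a 1 = 0 ∧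
      ∀ n z, HasPhase (n + 1) z (Φ chairPt).1 → OnDiagonal n a (k + z) := by
    intro s hs
    obtain ⟨y, y', hy, hy', hne, hl⟩ := exists_line_pair s hs
    obtain ⟨C, hC⟩ := h.exists_near
    obtain ⟨k, hk, hk'⟩ := exists_ne_of_strip (α := 1) (β := -s) (B := 2 * C + 1) (Φ y).2 (Φ y').2
      (fun e => hne (Φ.injective (Subtype.ext e))) (Or.inl one_ne_zero) fun p hp => by
        obtain ⟨j, hj, hj'⟩ := hC y y' p hp
        have h1 := abs_le.1 (hl _ hj')
        have h2 := abs_le.1 (hj 0)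
        have h3 := abs_le.1 (hj 1)
        simp only [Pi.add_apply, AddEquiv.refl_symm, AddEquiv.refl_apply] at h1
        rw [abs_le]
        rcases hs with rfl | rfl <;> constructor <;> linarith
    refine ⟨k, (Φ y).1 k, by linarith, fun n z hz => ?_⟩
    exact (((h.samePhases zeroPhase_chairFix hy).hasPhase hz).diagonal_of_ne
      ((h.samePhases zeroPhase_chairFix hy').hasPhase hz) hk).1
  obtain ⟨k, a, ha, hka⟩ := hline 1 (Or.inl rfl)
  obtain ⟨l, b, hb, hlb⟩ := hline (-1) (Or.inr rfl)
  have ha' : (a : ℕ) % 2 = 0 := by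
    clear hka; revert ha; revert a; decide
  have hb' : (b : ℕ) % 2 ≠ 0 := by
    clear hlb; revert hb; revert b; decide
  simp only [OnDiagonal, ha', hb', if_true, if_false, Pi.add_apply] at hka hlb
  have hpar : (k 0 - k 1 + l 0 + l 1 + 1) % 2 = 0 := by
    obtain ⟨z, hz⟩ := exists_hasPhase (Φ chairPt).2 2
    have h1 := hka 1 z hz
    have h2 := hlb 1 z hz
    omega
  refine ⟨![-((k 0 - k 1 + l 0 + l 1 + 1) / 2), -((l 0 + l 1 + 1 - k 0 + k 1) / 2)], fun n => ?_⟩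
  obtain ⟨z, hz⟩ := exists_hasPhase (Φ chairPt).2 (n + 2)
  have h1 := hka (n + 1) z hz
  have h2 := hlb (n + 1) z hz
  refine HasPhase.congr (z := z) (hz.of_le (by omega)) (Fin.forall_fin_two.2 ⟨?_, ?_⟩)
  · have := ((two_pow_succ_dvd_iff n _).1 (dvd_add h1 h2)).2
    obtain ⟨q, hq⟩ := this
    exact ⟨-q, by rw [mul_neg, ← hq, Matrix.cons_val_zero]; omega⟩
  · have := ((two_pow_succ_dvd_iff n _).1 (dvd_sub h2 h1)).2
    obtain ⟨q, hq⟩ := this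
    exact ⟨-q, by rw [mul_neg, ← hq, Matrix.cons_val_one, Matrix.cons_val_zero]; omega⟩

/-- The finite check behind the triviality of the symmetry group: `f` marks the quadrants at the
origin in which the letter points inwards. If the pattern is legal and stays legal when the letters
are reversed in all quadrants but one, for two choices of this quadrant, then all letters point
outwards. -/
theorem legal_flip_check : ∀ f : Fin 4 → Bool,
    ((Finset.univ.filter fun d => f d = true).card = 0 ∨
      (Finset.univ.filter fun d => f d = true).card = 3) →
    (∀ b : Fin 4, b.val < 2 →
      (Finset.univ.filter fun d => (if d = b then f d else !f d) = true).card = 0 ∨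
      (Finset.univ.filter fun d => (if d = b then f d else !f d) = true).card = 3) →
    ∀ d, f d = false := by decide

theorem ZeroPhase.eq_or {y : (Fin 2 → ℤ) → Fin 4} (h : ZeroPhase y) (d : Fin 4) :
    y (quadrantSquare d) = d ∨ y (quadrantSquare d) = d + 2 := by
  have := h.sameParity d
  generalize y (quadrantSquare d) = a at this
  revert a d; decide

/-- A homeomorphism that commutes with the shifts and preserves phases fixes the inflation
tiling. -/
theorem Intertwines.fix_chairPt {Φ : chairShift.Pt ≃ₜ chairShift.Pt}
    (h : Intertwines Φ (AddEquiv.refl _)) (h0 : ZeroPhase (Φ chairPt).1) : Φ chairPt = chairPt := by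
  have hz : ∀ y : chairShift.Pt, ZeroPhase y.1 → ZeroPhase (Φ y).1 := fun y hy n =>
    (h.samePhases zeroPhase_chairFix hy).hasPhase (h0 n)
  have hiff : ∀ y y' : chairShift.Pt, ZeroPhase y.1 → ZeroPhase y'.1 → ∀ d,
      ((Φ y).1 (quadrantSquare d) = (Φ y').1 (quadrantSquare d) ↔
        y.1 (quadrantSquare d) = y'.1 (quadrantSquare d)) := fun y y' hy hy' d =>
    ⟨fun e => by
        have hsymm : Intertwines Φ.symm (AddEquiv.refl _) := h.symm
        simpa only [Homeomorph.symm_apply_apply] using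
          hsymm.eq_quadrant (y := Φ y) (y' := Φ y') (hz y hy) (hz y' hy')
            (by rwa [Φ.symm_apply_apply]) (by rwa [Φ.symm_apply_apply]) e,
      fun e => h.eq_quadrant hy hy' (hz y hy) (hz y' hy') e⟩
  have hlegal : ∀ y : chairShift.Pt, LegalVertex fun d => y.1 (quadrantSquare d) := fun y => by
    simpa using legalVertex_of_mem y.2 0
  have hne2 : ∀ d : Fin 4, d ≠ d + 2 := by decide
  -- the image of a reflex point agrees with the image of the inflation tiling in one quadrant only
  let f : Fin 4 → Bool := fun d => decide ((Φ chairPt).1 (quadrantSquare d) = d + 2)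
  have hf : ∀ d, f d = false := by
    refine legal_flip_check f (by simpa [f, LegalVertex] using hlegal (Φ chairPt)) fun b _ => ?_
    obtain ⟨y, hy, hyb⟩ := exists_reflexPoint b
    have hyl := hlegal (Φ ⟨y, hy.mem⟩)
    have hd : ∀ d, (Φ ⟨y, hy.mem⟩).1 (quadrantSquare d) = d + 2 ↔
        (if d = b then f d else !f d) = true := by
      intro d
      have h1 := hiff chairPt ⟨y, hy.mem⟩ zeroPhase_chairFix hy d
      have h2 := (hz chairPt zeroPhase_chairFix).eq_or d
      have h3 := (hz ⟨y, hy.mem⟩ hy).eq_or d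
      have h4 : chairPt.1 (quadrantSquare d) = d := chairFix_quadrantSquare d
      have h5 := hne2 d
      simp only [h4, hyb] at h1
      simp only [f]
      generalize (Φ ⟨y, hy.mem⟩).1 (quadrantSquare d) = u at *
      generalize (Φ chairPt).1 (quadrantSquare d) = v at *
      split_ifs at h1 ⊢ <;> rcases h2 with rfl | rfl <;> rcases h3 with rfl | rfl <;> simp_all
    simpa only [LegalVertex, hd] using hyl
  apply Subtype.ext
  by_contra hne
  obtain ⟨k, hk⟩ := Function.ne_iff.1 hne
  obtain ⟨d, -, -, hd⟩ := h0.exists_ray_of_ne zeroPhase_chairFix hk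
  apply hd
  rw [chairFix_quadrantSquare]
  have := hf d
  simp only [f, decide_eq_false_iff_not] at this
  exact (h0.eq_or d).resolve_right this

theorem chairShift_symmetryGroup : chairShift.symmetryGroup = chairShift.shiftGroup := by
  apply le_antisymm
  · intro Φ hΦ
    have hcomm : ∀ k, chairShift.S k * Φ = Φ * chairShift.S k := fun k =>
      Subgroup.mem_centralizer_iff.1 hΦ _ (S_mem_shiftGroup k)
    have h : Intertwines Φ (AddEquiv.refl _) := fun k y => congrArg (· y) (hcomm k).symm
    obtain ⟨m, hm⟩ := h.exists_phase
    have h' : Intertwines (chairShift.S (-m) * Φ) (AddEquiv.refl _) := fun k y => by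
      change chairShift.S (-m) (Φ (chairShift.S k y)) = chairShift.S k (chairShift.S (-m) (Φ y))
      rw [h, S_apply_apply, S_apply_apply, add_comm]; rfl
    have hfix := h'.fix_chairPt fun n => by
      have := (hm n).translate (-m)
      rwa [neg_add_cancel] at this
    have hone : chairShift.S (-m) * Φ = 1 := by
      apply Homeomorph.ext
      refine congrFun (dense_orbit_chairPt.equalizer (Homeomorph.continuous _) continuous_id ?_)
      funext k
      change (chairShift.S (-m) * Φ) (chairShift.S k chairPt) = chairShift.S k chairPt
      rw [h', hfix]; rfl
    refine mem_shiftGroup_iff.2 ⟨m, ?_⟩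
    rw [← mul_one (chairShift.S m), ← hone, ← mul_assoc, ← S_add, add_neg_cancel, S_zero, one_mul]
  · intro Φ hΦ
    obtain ⟨k, rfl⟩ := mem_shiftGroup_iff.1 hΦ
    refine Subgroup.mem_centralizer_iff.2 fun Ψ hΨ => ?_
    obtain ⟨l, rfl⟩ := mem_shiftGroup_iff.1 hΨ
    rw [← S_add, ← S_add, add_comm]

/-! ### The action of the signed permutations on configurations -/

/-- The linear action of a signed permutation on `ℤ²`. -/
def linAct (g : hyperoctahedral 2) (v : Fin 2 → ℤ) : Fin 2 → ℤ :=
  ((g : GL (Fin 2) ℤ) : Matrix (Fin 2) (Fin 2) ℤ).mulVec v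

theorem linAct_add (g : hyperoctahedral 2) (v w : Fin 2 → ℤ) :
    linAct g (v + w) = linAct g v + linAct g w := Matrix.mulVec_add _ _ _

theorem linAct_neg (g : hyperoctahedral 2) (v : Fin 2 → ℤ) :
    linAct g (-v) = -linAct g v := Matrix.mulVec_neg _ _

theorem linAct_smul (g : hyperoctahedral 2) (c : ℤ) (v : Fin 2 → ℤ) :
    linAct g (c • v) = c • linAct g v := Matrix.mulVec_smul _ _ _

theorem linAct_one (v : Fin 2 → ℤ) : linAct 1 v = v := Matrix.one_mulVec v

theorem linAct_mul (g h : hyperoctahedral 2) (v : Fin 2 → ℤ) :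
    linAct (g * h) v = linAct g (linAct h v) := (Matrix.mulVec_mulVec _ _ _).symm

theorem linAct_inv_linAct (g : hyperoctahedral 2) (v : Fin 2 → ℤ) :
    linAct g⁻¹ (linAct g v) = v := by
  rw [← linAct_mul, inv_mul_cancel, linAct_one]

theorem signedPermMatrix_mulVec (π : Equiv.Perm (Fin 2)) (ε : Fin 2 → ℤˣ) (v : Fin 2 → ℤ)
    (i : Fin 2) : (signedPermMatrix π ε).mulVec v i = ε (π⁻¹ i) * v (π⁻¹ i) := by
  rw [Matrix.mulVec, dotProduct, Finset.sum_eq_single (π⁻¹ i)]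
  · simp [signedPermMatrix]
  · intro j _ hj
    have : i ≠ π j := fun h => hj (by simp [h])
    simp [signedPermMatrix, this]
  · simp

theorem exists_linAct_apply (g : hyperoctahedral 2) (v : Fin 2 → ℤ) (i : Fin 2) :
    ∃ j, linAct g v i = v j ∨ linAct g v i = -v j := by
  obtain ⟨π, ε, h⟩ := g.2
  refine ⟨π⁻¹ i, ?_⟩
  rw [linAct, h, signedPermMatrix_mulVec]
  rcases Int.units_eq_one_or (ε (π⁻¹ i)) with h | h <;> rw [h] <;> simp

theorem two_smul_add_one_injective : Function.Injective fun m : Fin 2 → ℤ => (2 : ℤ) • m + 1 := by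
  intro m n h
  funext i
  have := congrFun h i
  simp only [Pi.add_apply, Pi.smul_apply, smul_eq_mul, Pi.one_apply] at this
  omega

theorem exists_posAct (g : hyperoctahedral 2) (n : Fin 2 → ℤ) :
    ∃ m : Fin 2 → ℤ, (2 : ℤ) • m + 1 = linAct g ((2 : ℤ) • n + 1) := by
  refine ⟨fun i => (linAct g ((2 : ℤ) • n + 1) i - 1) / 2, ?_⟩
  funext i
  obtain ⟨j, hj⟩ := exists_linAct_apply g ((2 : ℤ) • n + 1) i
  simp only [Pi.add_apply, Pi.smul_apply, smul_eq_mul, Pi.one_apply] at *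
  omega

theorem exists_letterAct (g : hyperoctahedral 2) (a : Fin 4) :
    ∃ b : Fin 4, diagDir b = linAct g (diagDir a) := by
  have hd : ∀ a : Fin 4, ∀ i, diagDir a i = 1 ∨ diagDir a i = -1 := by decide
  have h : ∀ i, linAct g (diagDir a) i = 1 ∨ linAct g (diagDir a) i = -1 := fun i => by
    obtain ⟨j, hj⟩ := exists_linAct_apply g (diagDir a) i
    have := hd a j
    omega
  generalize linAct g (diagDir a) = v at h
  rcases h 0 with h0 | h0 <;> rcases h 1 with h1 | h1
  · exact ⟨0, by funext i; fin_cases i <;> simp [diagDir, h0, h1]⟩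
  · exact ⟨1, by funext i; fin_cases i <;> simp [diagDir, h0, h1]⟩
  · exact ⟨3, by funext i; fin_cases i <;> simp [diagDir, h0, h1]⟩
  · exact ⟨2, by funext i; fin_cases i <;> simp [diagDir, h0, h1]⟩

/-- The action of a signed permutation on unit squares, which are indexed by their lower left
corners: it is linear on the centres. -/
noncomputable def posAct (g : hyperoctahedral 2) (n : Fin 2 → ℤ) : Fin 2 → ℤ :=
  (exists_posAct g n).choose

theorem posAct_spec (g : hyperoctahedral 2) (n : Fin 2 → ℤ) :
    (2 : ℤ) • posAct g n + 1 = linAct g ((2 : ℤ) • n + 1) := (exists_posAct g n).choose_spec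

/-- The action of a signed permutation on letters, as on diagonal directions. -/
noncomputable def letterAct (g : hyperoctahedral 2) (a : Fin 4) : Fin 4 :=
  (exists_letterAct g a).choose

theorem diagDir_letterAct (g : hyperoctahedral 2) (a : Fin 4) :
    diagDir (letterAct g a) = linAct g (diagDir a) := (exists_letterAct g a).choose_spec

theorem posAct_mul (g h : hyperoctahedral 2) (n : Fin 2 → ℤ) :
    posAct (g * h) n = posAct g (posAct h n) := by
  apply two_smul_add_one_injective
  simp only [posAct_spec, linAct_mul]

theorem posAct_add (g : hyperoctahedral 2) (n k : Fin 2 → ℤ) :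
    posAct g (n + k) = posAct g n + linAct g k := by
  apply two_smul_add_one_injective
  simp only [posAct_spec]
  rw [smul_add, smul_add, add_right_comm, linAct_add, ← posAct_spec, linAct_smul, add_right_comm]

theorem letterAct_mul (g h : hyperoctahedral 2) (a : Fin 4) :
    letterAct (g * h) a = letterAct g (letterAct h a) := by
  apply diagDir_injective
  simp only [diagDir_letterAct, linAct_mul]

theorem posAct_one (n : Fin 2 → ℤ) : posAct 1 n = n := by
  apply two_smul_add_one_injective
  simp only [posAct_spec, linAct_one]

theorem letterAct_one (a : Fin 4) : letterAct 1 a = a := by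
  apply diagDir_injective
  simp only [diagDir_letterAct, linAct_one]

theorem letterAct_injective (g : hyperoctahedral 2) : Function.Injective (letterAct g) := by
  intro a b h
  have := congrArg (letterAct g⁻¹) h
  rwa [← letterAct_mul, ← letterAct_mul, inv_mul_cancel, letterAct_one, letterAct_one] at this

theorem letterAct_add_two (g : hyperoctahedral 2) (a : Fin 4) :
    letterAct g (a + 2) = letterAct g a + 2 := by
  apply diagDir_injective
  simp only [diagDir_letterAct, diagDir_add_two, linAct_neg]

theorem chairSubst_letterAct (g : hyperoctahedral 2) (a c : Fin 4) :
    chairSubst (letterAct g a) (letterAct g c) = letterAct g (chairSubst a c) := by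
  unfold chairSubst
  simp only [(letterAct_injective g).eq_iff, ← letterAct_add_two]
  split_ifs <;> rfl

theorem blockIndex_blockCorner_posAct (g : hyperoctahedral 2) (m : Fin 2 → ℤ) :
    blockIndex (posAct g m) = posAct g (blockIndex m) ∧
      blockCorner (posAct g m) = letterAct g (blockCorner m) := by
  apply blockIndex_blockCorner_unique
  rw [posAct_spec, posAct_spec, diagDir_letterAct, centre_eq, linAct_add, linAct_smul]

theorem quadrantSquare_letterAct (g : hyperoctahedral 2) (d : Fin 4) :
    quadrantSquare (letterAct g d) = posAct g (quadrantSquare d) := by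
  apply two_smul_add_one_injective
  simp only [posAct_spec, ← diagDir_eq, diagDir_letterAct]

/-- A signed permutation moves the squares and turns their letters. -/
noncomputable def geomConfig (g : hyperoctahedral 2) (y : (Fin 2 → ℤ) → Fin 4) :
    (Fin 2 → ℤ) → Fin 4 := fun n => letterAct g (y (posAct g⁻¹ n))

theorem continuous_geomConfig (g : hyperoctahedral 2) : Continuous (geomConfig g) :=
  continuous_pi fun n =>
    (continuous_of_discreteTopology (f := letterAct g)).comp (continuous_apply (posAct g⁻¹ n))

theorem geomConfig_mul (g h : hyperoctahedral 2) (y : (Fin 2 → ℤ) → Fin 4) :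
    geomConfig (g * h) y = geomConfig g (geomConfig h y) := by
  funext n
  simp only [geomConfig, letterAct_mul, mul_inv_rev, posAct_mul]

theorem geomConfig_one (y : (Fin 2 → ℤ) → Fin 4) : geomConfig 1 y = y := by
  funext n
  simp only [geomConfig, letterAct_one, inv_one, posAct_one]

theorem geomConfig_translate (g : hyperoctahedral 2) (k : Fin 2 → ℤ) (y : (Fin 2 → ℤ) → Fin 4) :
    geomConfig g (translateConfig k y) = translateConfig (linAct g k) (geomConfig g y) := by
  funext n
  simp only [geomConfig, translateConfig, posAct_add, linAct_inv_linAct]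

theorem geomConfig_inflate (g : hyperoctahedral 2) (y : (Fin 2 → ℤ) → Fin 4) :
    geomConfig g (inflate y) = inflate (geomConfig g y) := by
  funext n
  have h := blockIndex_blockCorner_posAct g⁻¹ n
  simp only [geomConfig, inflate, h.1, h.2]
  rw [← chairSubst_letterAct, ← letterAct_mul, mul_inv_cancel, letterAct_one]

theorem geomConfig_chairFix (g : hyperoctahedral 2) : geomConfig g chairFix = chairFix := by
  refine eq_of_inflate_eq ?_ inflate_chairFix fun d => ?_
  · rw [← geomConfig_inflate, inflate_chairFix]
  · rw [geomConfig, ← quadrantSquare_letterAct, chairFix_quadrantSquare, chairFix_quadrantSquare,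
      ← letterAct_mul, mul_inv_cancel, letterAct_one]

theorem geomConfig_mem (g : hyperoctahedral 2) {y : (Fin 2 → ℤ) → Fin 4}
    (hy : y ∈ chairShift.carrier) : geomConfig g y ∈ chairShift.carrier := by
  refine chairShift_induction (P := geomConfig g ⁻¹' chairShift.carrier)
    (chairShift.isClosed.preimage (continuous_geomConfig g)) (fun k => ?_) hy
  rw [Set.mem_preimage, geomConfig_translate, geomConfig_chairFix]
  exact translate_chairFix_mem _

/-- The action of the signed permutations on the shift space. -/
noncomputable def geomHom : hyperoctahedral 2 →* (chairShift.Pt ≃ₜ chairShift.Pt) where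
  toFun g :=
    { toFun := fun y => ⟨geomConfig g y.1, geomConfig_mem g y.2⟩
      invFun := fun y => ⟨geomConfig g⁻¹ y.1, geomConfig_mem g⁻¹ y.2⟩
      left_inv := fun y => Subtype.ext
        (by simp only [← geomConfig_mul, inv_mul_cancel, geomConfig_one])
      right_inv := fun y => Subtype.ext
        (by simp only [← geomConfig_mul, mul_inv_cancel, geomConfig_one])
      continuous_toFun := ((continuous_geomConfig g).comp continuous_subtype_val).subtype_mk _
      continuous_invFun := ((continuous_geomConfig g⁻¹).comp continuous_subtype_val).subtype_mk _ }
  map_one' := Homeomorph.ext fun y => Subtype.ext (geomConfig_one y.1)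
  map_mul' g h := Homeomorph.ext fun y => Subtype.ext (geomConfig_mul g h y.1)

theorem geomHom_conj (g : hyperoctahedral 2) (k : Fin 2 → ℤ) :
    geomHom g * chairShift.S k * (geomHom g)⁻¹ = chairShift.S (linAct g k) := by
  rw [mul_inv_eq_iff_eq_mul]
  exact Homeomorph.ext fun y => Subtype.ext (geomConfig_translate g k y.1)

theorem eq_one_of_linAct_eq {g : hyperoctahedral 2} (h : ∀ k, linAct g k = k) : g = 1 := by
  apply Subtype.ext
  apply Units.ext
  apply Matrix.ext_of_mulVec_single
  intro i
  rw [← linAct, h]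
  exact (Matrix.one_mulVec _).symm

theorem eq_one_of_geomHom_eq_S {g : hyperoctahedral 2} {l : Fin 2 → ℤ}
    (h : geomHom g = chairShift.S l) : g = 1 := by
  refine eq_one_of_linAct_eq fun k => S_injective ?_
  rw [← geomHom_conj, h, ← S_add, add_comm, S_add, mul_inv_cancel_right]

theorem geomHom_injective : Function.Injective geomHom := by
  rw [injective_iff_map_eq_one]
  intro g hg
  exact eq_one_of_geomHom_eq_S (l := 0) (by rw [hg, S_zero])

/-! ### The extended symmetry group -/

/-- A signed permutation as an element of the hyperoctahedral group. -/
def signedPermGL (π : Equiv.Perm (Fin 2)) (ε : Fin 2 → ℤˣ) : hyperoctahedral 2 where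
  val :=
    { val := signedPermMatrix π ε
      inv := signedPermMatrix π⁻¹ fun j => (ε (π⁻¹ j))⁻¹
      val_inv := by simp [signedPermMatrix_mul, signedPermMatrix_one]
      inv_val := by simp [signedPermMatrix_mul, signedPermMatrix_one] }
  property := ⟨π, ε, rfl⟩

theorem shiftGroup_le : chairShift.shiftGroup ≤ chairShift.extendedSymmetryGroup :=
  Subgroup.le_normalizer

theorem geomHom_mem (g : hyperoctahedral 2) : geomHom g ∈ chairShift.extendedSymmetryGroup := by
  have h : ∀ g : hyperoctahedral 2, ∀ Φ ∈ chairShift.shiftGroup,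
      geomHom g * Φ * (geomHom g)⁻¹ ∈ chairShift.shiftGroup := fun g Φ hΦ => by
    obtain ⟨k, rfl⟩ := mem_shiftGroup_iff.1 hΦ
    rw [geomHom_conj]
    exact S_mem_shiftGroup _
  refine Subgroup.mem_normalizer_iff.2 fun Φ => ⟨h g Φ, fun hΦ => ?_⟩
  have := h g⁻¹ _ hΦ
  rw [map_inv] at this
  convert this using 1
  group

/-- An extended symmetry is a shift up to the signed permutation given by its matrix. -/
theorem exists_geomHom_mul {H : chairShift.Pt ≃ₜ chairShift.Pt}
    (hH : H ∈ chairShift.extendedSymmetryGroup) : ∃ g k, H = geomHom g * chairShift.S k := by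
  obtain ⟨M, hM⟩ := exists_intertwines hH
  obtain ⟨π, ε, h⟩ := hM.exists_signedPerm
  have hlin : ∀ k, M k = linAct (signedPermGL π ε) k := by
    intro k
    have h' : ∀ i, linAct (signedPermGL π ε) (Pi.single i 1) = M (Pi.single i 1) := by
      intro i
      rw [h]
      funext j
      change (signedPermMatrix π ε).mulVec _ j = _
      rw [Matrix.mulVec_single_one]
      simp [signedPermMatrix, Pi.single_apply]
    rw [map_eq_smul_add_smul, ← h', ← h', ← linAct_smul, ← linAct_smul, ← linAct_add]
    congr 1
    funext i; fin_cases i <;> simp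
  have hmem : (geomHom (signedPermGL π ε))⁻¹ * H ∈ chairShift.symmetryGroup := by
    refine Subgroup.mem_centralizer_iff.2 fun Φ hΦ => ?_
    obtain ⟨k, rfl⟩ := mem_shiftGroup_iff.1 hΦ
    have h1 := intertwines_iff.1 hM k
    rw [hlin, ← geomHom_conj, mul_inv_eq_iff_eq_mul] at h1
    rw [mul_assoc, h1]
    group
  rw [chairShift_symmetryGroup] at hmem
  obtain ⟨k, hk⟩ := mem_shiftGroup_iff.1 hmem
  exact ⟨signedPermGL π ε, k, by rw [hk, mul_inv_cancel_left]⟩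

theorem chairShift_semidirect : ∃ K : Subgroup (chairShift.Pt ≃ₜ chairShift.Pt),
    IsInternalSemidirect chairShift.extendedSymmetryGroup chairShift.shiftGroup K ∧
    ∃ e : K ≃* hyperoctahedral 2,
      ∀ h : K, chairShift.ConjActsBy (h : chairShift.Pt ≃ₜ chairShift.Pt)
        (e h : GL (Fin 2) ℤ) := by
  refine ⟨geomHom.range, ⟨shiftGroup_le, ?_, le_rfl, ?_, ?_⟩,
    (MonoidHom.ofInjective geomHom_injective).symm, fun h => ?_⟩
  · rintro _ ⟨g, rfl⟩
    exact geomHom_mem g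
  · rw [eq_bot_iff]
    rintro _ ⟨h, g, rfl⟩
    obtain ⟨k, hk⟩ := mem_shiftGroup_iff.1 h
    rw [eq_one_of_geomHom_eq_S hk.symm, map_one]
    exact Subgroup.one_mem _
  · apply le_antisymm
    · refine sup_le shiftGroup_le ?_
      rintro _ ⟨g, rfl⟩
      exact geomHom_mem g
    · intro H hH
      obtain ⟨g, k, rfl⟩ := exists_geomHom_mul hH
      exact mul_mem (Subgroup.mem_sup_right ⟨g, rfl⟩) (Subgroup.mem_sup_left (S_mem_shiftGroup k))
  · obtain ⟨g, rfl⟩ := (MonoidHom.ofInjective geomHom_injective).surjective h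
    rw [MulEquiv.symm_apply_apply]
    exact geomHom_conj g

/-! ### The group of signed permutation matrices -/

/-- The standard matrices of the dihedral group of order `8`. -/
def dihedralMatrix : DihedralGroup 4 → Matrix (Fin 2) (Fin 2) ℤ
  | .r i => (![!![1, 0; 0, 1], !![0, -1; 1, 0], !![-1, 0; 0, -1], !![0, 1; -1, 0]] :
      Fin 4 → Matrix (Fin 2) (Fin 2) ℤ) i
  | .sr i => (![!![1, 0; 0, -1], !![0, -1; -1, 0], !![-1, 0; 0, 1], !![0, 1; 1, 0]] :
      Fin 4 → Matrix (Fin 2) (Fin 2) ℤ) i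

/-- The standard representation of the dihedral group of order `8`. -/
def dihedralHom : DihedralGroup 4 →* GL (Fin 2) ℤ :=
  MonoidHom.toHomUnits
    { toFun := dihedralMatrix
      map_one' := by decide
      map_mul' := by
        rintro (i | i) (j | j) <;> revert i j <;> decide +kernel }

theorem dihedralHom_injective : Function.Injective dihedralHom := by
  have h : Function.Injective dihedralMatrix := by
    rintro (i | i) (j | j) <;> revert i j <;> decide +kernel
  intro a b hab
  exact h (congrArg Units.val hab)

theorem dihedralHom_range : dihedralHom.range = hyperoctahedral 2 := by
  ext M
  constructor
  · rintro ⟨g, rfl⟩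
    have h : ∀ g, ∃ (π : Equiv.Perm (Fin 2)) (ε : Fin 2 → ℤˣ),
        dihedralMatrix g = signedPermMatrix π ε := by
      rintro (i | i) <;> revert i <;> decide +kernel
    exact h g
  · rintro ⟨π, ε, h⟩
    have h' : ∀ (π : Equiv.Perm (Fin 2)) (ε : Fin 2 → ℤˣ), ∃ g,
        dihedralMatrix g = signedPermMatrix π ε := by
      decide +kernel
    obtain ⟨g, hg⟩ := h' π ε
    exact ⟨g, Units.ext (hg.trans h.symm)⟩

theorem nonempty_hyperoctahedral_mulEquiv : Nonempty (hyperoctahedral 2 ≃* DihedralGroup 4) :=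
  ⟨((MonoidHom.ofInjective dihedralHom_injective).trans
    (MulEquiv.subgroupCongr dihedralHom_range)).symm⟩

theorem exists_signedPermMatrix_of_orthogonal {A : Matrix (Fin 2) (Fin 2) ℤ}
    (h : A.transpose * A = 1) : ∃ (π : Equiv.Perm (Fin 2)) (ε : Fin 2 → ℤˣ),
      A = signedPermMatrix π ε := by
  have h00 := congrFun (congrFun h 0) 0
  have h01 := congrFun (congrFun h 0) 1
  have h11 := congrFun (congrFun h 1) 1
  simp [Matrix.mul_apply, Fin.sum_univ_two] at h00 h01 h11
  have key : ∀ {a b : ℤ}, a * a + b * b = 1 →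
      (b = 0 ∧ ∃ e : ℤˣ, (e : ℤ) = a) ∨ (a = 0 ∧ ∃ e : ℤˣ, (e : ℤ) = b) := by
    intro a b hab
    rcases eq_or_ne a 0 with rfl | ha
    · exact Or.inr ⟨rfl, IsUnit.of_mul_eq_one b (by linarith)⟩
    · have hb : b = 0 := by
        by_contra hb
        have h1 := mul_self_pos.2 ha
        have h2 := mul_self_pos.2 hb
        omega
      exact Or.inl ⟨hb, IsUnit.of_mul_eq_one a (by rw [hb] at hab; linarith)⟩
  rcases key h00 with ⟨h1, e, he⟩ | ⟨h1, e, he⟩ <;> rcases key h11 with ⟨h2, f, hf⟩ | ⟨h2, f, hf⟩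
  · exfalso; simp [h1, h2, ← he, ← hf] at h01
  · refine ⟨1, ![e, f], ?_⟩
    ext i j; fin_cases i <;> fin_cases j <;> simp [signedPermMatrix, *]
  · refine ⟨Equiv.swap 0 1, ![e, f], ?_⟩
    ext i j; fin_cases i <;> fin_cases j <;> simp [signedPermMatrix, *]
  · exfalso; simp [h1, h2, ← he, ← hf] at h01

/-- A finite group that contains the signed permutation matrices preserves a quadratic form, the
sum of the forms `gᵀ g`; since the signed permutations preserve it too, it is a multiple of the
standard form. -/
theorem hyperoctahedral_maximal :
    Maximal (fun K : Subgroup (GL (Fin 2) ℤ) => Finite K) (hyperoctahedral 2) := by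
  refine ⟨?_, fun K hK hle h hh => ?_⟩
  · obtain ⟨e⟩ := nonempty_hyperoctahedral_mulEquiv
    exact Finite.of_equiv _ e.symm.toEquiv
  have := Fintype.ofFinite K
  set Q : Matrix (Fin 2) (Fin 2) ℤ :=
    ∑ g : K, ((g : GL (Fin 2) ℤ) : Matrix (Fin 2) (Fin 2) ℤ).transpose *
      ((g : GL (Fin 2) ℤ) : Matrix (Fin 2) (Fin 2) ℤ) with hQ
  have hinv : ∀ M ∈ K, (M : Matrix (Fin 2) (Fin 2) ℤ).transpose * Q *
      (M : Matrix (Fin 2) (Fin 2) ℤ) = Q := by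
    intro M hM
    rw [hQ, Finset.mul_sum, Finset.sum_mul]
    refine Fintype.sum_equiv (Equiv.mulRight ⟨M, hM⟩) _ _ fun g => ?_
    simp [Matrix.mul_assoc]
  -- invariance under a reflection and under the exchange of the coordinates makes `Q` scalar
  have hs := hinv _ (hle (signedPermGL 1 ![1, -1]).2)
  have ht := hinv _ (hle (signedPermGL (Equiv.swap 0 1) 1).2)
  have hs01 := congrFun (congrFun hs 0) 1
  have hs10 := congrFun (congrFun hs 1) 0
  have ht00 := congrFun (congrFun ht 0) 0
  simp [Matrix.mul_apply, Fin.sum_univ_two, signedPermGL, signedPermMatrix] at hs01 hs10 ht00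
  have hQ01 : Q 0 1 = 0 := by linarith
  have hQ10 : Q 1 0 = 0 := by linarith
  have hpos : Q 0 0 ≠ 0 := by
    have h1 : 0 < Q 0 0 := by
      rw [hQ, Matrix.sum_apply]
      refine Finset.sum_pos' (fun g _ => ?_) ⟨1, Finset.mem_univ _, ?_⟩
      · simp only [Matrix.mul_apply, Matrix.transpose_apply]
        exact Finset.sum_nonneg fun i _ => mul_self_nonneg _
      · simp
    exact h1.ne'
  have hQc : Q = Q 0 0 • (1 : Matrix (Fin 2) (Fin 2) ℤ) := by
    ext i j; fin_cases i <;> fin_cases j <;> simp [hQ01, hQ10, ht00]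
  apply exists_signedPermMatrix_of_orthogonal
  have h1 := hinv h hh
  rw [hQc, Matrix.mul_smul, Matrix.mul_one, Matrix.smul_mul] at h1
  exact smul_right_injective _ hpos h1

/-! ### Phase functions and eigenfunctions -/

/-- The phase of a point modulo `2 ^ n`, as an element of a finite group. -/
noncomputable def phaseMod (n : ℕ) (y : chairShift.Pt) : Fin 2 → ZMod (2 ^ n) :=
  fun i => ((exists_hasPhase y.2 n).choose i : ℤ)

theorem phaseMod_eq_iff {n : ℕ} {y : chairShift.Pt} {z : Fin 2 → ℤ} :
    (phaseMod n y = fun i => (z i : ZMod (2 ^ n))) ↔ HasPhase n z y.1 := by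
  have h := (exists_hasPhase y.2 n).choose_spec
  have hcast : ∀ a b : ℤ, (a : ZMod (2 ^ n)) = b ↔ (2 ^ n : ℤ) ∣ b - a := fun a b => by
    rw [ZMod.intCast_eq_intCast_iff_dvd_sub]; push_cast; rfl
  rw [funext_iff]
  simp only [phaseMod, hcast]
  exact ⟨fun hz => h.congr hz, fun hz => hz.unique h⟩

theorem exists_lift_zmod {n : ℕ} (w : Fin 2 → ZMod (2 ^ n)) :
    ∃ z : Fin 2 → ℤ, w = fun i => (z i : ZMod (2 ^ n)) := by
  choose z hz using fun i => ZMod.intCast_surjective (w i)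
  exact ⟨z, funext fun i => (hz i).symm⟩

theorem phaseMod_S (n : ℕ) (k : Fin 2 → ℤ) (y : chairShift.Pt) :
    phaseMod n (chairShift.S k y) = (fun i => (k i : ZMod (2 ^ n))) + phaseMod n y := by
  obtain ⟨z, hz⟩ := exists_hasPhase y.2 n
  rw [phaseMod_eq_iff.2 hz]
  have h : HasPhase n (k + z) (chairShift.S k y).1 := hz.translate k
  rw [phaseMod_eq_iff.2 h]
  funext i
  simp

theorem isLocallyConstant_phaseMod (n : ℕ) : IsLocallyConstant (phaseMod n) := by
  have hclosed : ∀ s : Set (Fin 2 → ZMod (2 ^ n)), IsClosed (phaseMod n ⁻¹' s) := fun s => by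
    rw [← Set.biUnion_preimage_singleton]
    refine s.toFinite.isClosed_biUnion fun w _ => ?_
    obtain ⟨z, rfl⟩ := exists_lift_zmod w
    have : phaseMod n ⁻¹' {fun i => (z i : ZMod (2 ^ n))} =
        Subtype.val ⁻¹' {y | HasPhase n z y} := by
      ext y; exact phaseMod_eq_iff
    rw [this]
    exact (isClosed_hasPhase n z).preimage continuous_subtype_val
  intro s
  rw [← isClosed_compl_iff, ← Set.preimage_compl]
  exact hclosed _

/-- A function of the phase modulo `2 ^ n`, as a continuous function on the shift space. -/
noncomputable def phaseFun (n : ℕ) :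
    ((Fin 2 → ZMod (2 ^ n)) → ℂ) →ₗ[ℂ] C(chairShift.Pt, ℂ) where
  toFun F := ⟨fun y => F (phaseMod n y), ((isLocallyConstant_phaseMod n).comp F).continuous⟩
  map_add' _ _ := rfl
  map_smul' _ _ := rfl

theorem isL2Eigenfunction_phaseFun {μ : Measure chairShift.Pt} (hμ : chairShift.IsInvariantProb μ)
    [IsFiniteMeasure μ] {n : ℕ} (ψ : AddChar (Fin 2 → ZMod (2 ^ n)) ℂ) :
    chairShift.IsL2Eigenfunction μ (ContinuousMap.toLp 2 μ ℂ (phaseFun n ψ)) := by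
  refine ⟨fun k => ψ fun i => (k i : ZMod (2 ^ n)), fun k => ?_⟩
  have h := ContinuousMap.coeFn_toLp (p := 2) (𝕜 := ℂ) μ (phaseFun n ψ)
  have h' := (hμ.2 k).quasiMeasurePreserving.ae_eq_comp h
  filter_upwards [h, h'] with y hy hy'
  simp only [Function.comp_apply] at hy'
  rw [hy, hy']
  change ψ (phaseMod n _) = _ * ψ (phaseMod n y)
  rw [phaseMod_S, AddChar.map_add_eq_mul]

theorem toLp_phaseFun_mem_span {μ : Measure chairShift.Pt} (hμ : chairShift.IsInvariantProb μ)
    [IsFiniteMeasure μ] {n : ℕ} (F : (Fin 2 → ZMod (2 ^ n)) → ℂ) :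
    ContinuousMap.toLp 2 μ ℂ (phaseFun n F) ∈
      Submodule.span ℂ {f : Lp ℂ 2 μ | chairShift.IsL2Eigenfunction μ f} := by
  have hF : F ∈ Submodule.span ℂ (Set.range (AddChar.complexBasis (Fin 2 → ZMod (2 ^ n)))) := by
    rw [Module.Basis.span_eq]; trivial
  have := Submodule.mem_map_of_mem
    (f := (ContinuousMap.toLp 2 μ ℂ).toLinearMap ∘ₗ phaseFun n) hF
  rw [Submodule.map_span] at this
  refine Submodule.span_mono ?_ this
  rintro _ ⟨_, ⟨ψ, rfl⟩, rfl⟩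
  rw [AddChar.complexBasis_apply]
  exact isL2Eigenfunction_phaseFun hμ ψ

/-! ### Almost every point is determined by its phases -/

/-- The points for which the square `k` lies on the diagonals, in the direction of `a`, of the
blocks of all levels. -/
def singularSet (k : Fin 2 → ℤ) (a : Fin 4) : Set chairShift.Pt :=
  {y | ∀ n z, HasPhase (n + 1) z y.1 → OnDiagonal n a (k + z)}

theorem measurableSet_singularSet (k : Fin 2 → ℤ) (a : Fin 4) :
    MeasurableSet (singularSet k a) := by
  have : singularSet k a = ⋂ n, ⋂ z, {y | HasPhase (n + 1) z y.1 → OnDiagonal n a (k + z)} := by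
    ext; simp [singularSet]
  rw [this]
  refine MeasurableSet.iInter fun n => MeasurableSet.iInter fun z => MeasurableSet.imp ?_ (.const _)
  exact ((isClosed_hasPhase (n + 1) z).preimage continuous_subtype_val).measurableSet

/-- The translates of a singular set along a coordinate axis are pairwise disjoint, so that it is a
null set. -/
theorem measure_singularSet {μ : Measure chairShift.Pt} (hμ : chairShift.IsInvariantProb μ)
    (k : Fin 2 → ℤ) (a : Fin 4) : μ (singularSet k a) = 0 := by
  have := hμ.1
  set T : ℤ → Set chairShift.Pt := fun j =>
    chairShift.S (Pi.single 0 j) ⁻¹' singularSet k a with hT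
  have hmeas : ∀ j, MeasurableSet (T j) := fun j =>
    (chairShift.S _).continuous.measurable (measurableSet_singularSet k a)
  have hdisj : Pairwise (Function.onFun Disjoint T) := by
    intro i j hij
    rw [Function.onFun, Set.disjoint_left]
    intro y hi hj
    apply hij
    rw [← sub_eq_zero]
    refine eq_zero_of_two_pow_dvd fun n => ?_
    obtain ⟨z, hz⟩ := exists_hasPhase y.2 (n + 1)
    have h1 := hi n _ (hz.translate _)
    have h2 := hj n _ (hz.translate _)
    unfold OnDiagonal at h1 h2
    split_ifs at h1 h2
    all_goals
      obtain ⟨q, hq⟩ := dvd_sub h1 h2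
      refine ⟨q, ?_⟩
      rw [← hq]
      simp only [Pi.add_apply, Pi.single_eq_same, Pi.single_apply, Fin.isValue, one_ne_zero,
        if_false]
      ring
  have hsum := tsum_meas_le_meas_iUnion_of_disjoint μ hmeas hdisj
  have hconst : ∀ j, μ (T j) = μ (singularSet k a) := fun j =>
    (hμ.2 _).measure_preimage (measurableSet_singularSet k a).nullMeasurableSet
  simp only [hconst] at hsum
  by_contra hne
  rw [ENNReal.tsum_const_eq_top_of_ne_zero hne] at hsum
  exact measure_ne_top μ _ (top_le_iff.1 hsum)

/-- Almost every point is determined by its phases. -/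
theorem ae_determined {μ : Measure chairShift.Pt} (hμ : chairShift.IsInvariantProb μ) :
    ∀ᵐ y ∂μ, ∀ y' : chairShift.Pt, (∀ n, phaseMod n y' = phaseMod n y) → y' = y := by
  have h : ∀ᵐ y ∂μ, ∀ k a, y ∉ singularSet k a := by
    rw [ae_all_iff]; intro k
    rw [ae_all_iff]; intro a
    exact measure_eq_zero_iff_ae_notMem.1 (measure_singularSet hμ k a)
  filter_upwards [h] with y hy y' hy'
  by_contra hne
  obtain ⟨k, hk⟩ := Function.ne_iff.1 fun e => hne (Subtype.ext e).symm
  refine hy k (y.1 k) fun n z hz => ?_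
  have hz' : HasPhase (n + 1) z y'.1 := by
    rw [← phaseMod_eq_iff, hy', phaseMod_eq_iff]; exact hz
  exact (hz.diagonal_of_ne hz' hk).1

theorem phaseMod_eq_of_le {n N : ℕ} (h : n ≤ N) {y y' : chairShift.Pt}
    (hN : phaseMod N y = phaseMod N y') : phaseMod n y = phaseMod n y' := by
  obtain ⟨z, hz⟩ := exists_hasPhase y'.2 N
  rw [phaseMod_eq_iff.2 hz, phaseMod_eq_iff] at hN
  rw [phaseMod_eq_iff.2 (hN.of_le h), phaseMod_eq_iff.2 (hz.of_le h)]

/-- A point determined by its phases is the limit of any points with the same phases modulo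
`2 ^ n`. -/
theorem tendsto_of_phaseMod_eq {y : chairShift.Pt}
    (hy : ∀ y' : chairShift.Pt, (∀ n, phaseMod n y' = phaseMod n y) → y' = y)
    {p : ℕ → chairShift.Pt} (hp : ∀ n, phaseMod n (p n) = phaseMod n y) :
    Filter.Tendsto p Filter.atTop (nhds y) := by
  refine Filter.tendsto_of_subseq_tendsto fun ns hns => ?_
  obtain ⟨a, ms, hms, ha⟩ := CompactSpace.tendsto_subseq (p ∘ ns)
  refine ⟨ms, ?_⟩
  suffices h : a = y by rw [← h]; exact ha
  refine hy a fun n => ?_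
  have h1 : ∀ᶠ j in Filter.atTop, phaseMod n (p (ns (ms j))) = phaseMod n a :=
    ha.eventually ((isLocallyConstant_phaseMod n).eventually_eq a)
  have h2 : ∀ᶠ j in Filter.atTop, n ≤ ns (ms j) :=
    (hns.comp hms.tendsto_atTop).eventually_ge_atTop n
  obtain ⟨j, h1, h2⟩ := (h1.and h2).exists
  rw [← h1]
  exact phaseMod_eq_of_le h2 (hp _)

/-- Dominated convergence in `L²` for uniformly bounded continuous functions. -/
theorem tendsto_toLp_of_bounded {μ : Measure chairShift.Pt} [IsFiniteMeasure μ]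
    {g : ℕ → C(chairShift.Pt, ℂ)} {f : C(chairShift.Pt, ℂ)} {C : ℝ} (hC : ∀ n y, ‖g n y‖ ≤ C)
    (h : ∀ᵐ y ∂μ, Filter.Tendsto (fun n => g n y) Filter.atTop (nhds (f y))) :
    Filter.Tendsto (fun n => ContinuousMap.toLp 2 μ ℂ (g n)) Filter.atTop
      (nhds (ContinuousMap.toLp 2 μ ℂ f)) := by
  rw [Lp.tendsto_Lp_iff_tendsto_eLpNorm']
  have hcoe := fun f : C(chairShift.Pt, ℂ) => ContinuousMap.coeFn_toLp (p := 2) (𝕜 := ℂ) μ f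
  refine (Filter.tendsto_congr fun n => eLpNorm_congr_ae ((hcoe (g n)).sub (hcoe f))).2 ?_
  refine tendsto_Lp_finite_of_tendsto_ae (by norm_num) (by norm_num)
    (fun n => (g n).continuous.aestronglyMeasurable) ?_ ?_ h
  · exact (memLp_congr_ae (hcoe f)).1 (Lp.memLp _)
  · refine unifIntegrable_of (by norm_num) (by norm_num)
      (fun n => (g n).continuous.aestronglyMeasurable) fun ε _ => ⟨(C + 1).toNNReal, fun n => ?_⟩
    have : {y | (C + 1).toNNReal ≤ ‖g n y‖₊} = ∅ := by
      refine Set.eq_empty_of_forall_notMem fun y hy => ?_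
      have h1 : C + 1 ≤ ‖g n y‖ := Real.toNNReal_le_iff_le_coe.1 hy
      linarith [hC n y]
    rw [this]
    simp

theorem dense_span_eigenfunctions {μ : Measure chairShift.Pt} (hμ : chairShift.IsInvariantProb μ) :
    Dense (Submodule.span ℂ {f : Lp ℂ 2 μ | chairShift.IsL2Eigenfunction μ f} :
      Set (Lp ℂ 2 μ)) := by
  classical
  have := hμ.1
  have hden := ContinuousMap.toLp_denseRange ℂ μ ℂ (p := 2) (by norm_num)
  rw [← dense_closure]
  refine hden.mono ?_
  rintro _ ⟨f, rfl⟩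
  -- approximate `f` by its values at representatives of the phases modulo `2 ^ n`
  have hsel : ∀ (n : ℕ) (y : chairShift.Pt), ∃ p, phaseMod n p = phaseMod n y := fun n y => ⟨y, rfl⟩
  let rep : ∀ n, (Fin 2 → ZMod (2 ^ n)) → chairShift.Pt := fun n w =>
    if h : ∃ p, phaseMod n p = w then h.choose else chairPt
  have hrep : ∀ n y, phaseMod n (rep n (phaseMod n y)) = phaseMod n y := fun n y => by
    simp only [rep, dif_pos (hsel n y)]
    exact (hsel n y).choose_spec
  refine mem_closure_of_tendsto (f := fun n =>
    ContinuousMap.toLp 2 μ ℂ (phaseFun n fun w => f (rep n w))) (b := Filter.atTop) ?_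
    (Filter.Eventually.of_forall fun n => toLp_phaseFun_mem_span hμ _)
  refine tendsto_toLp_of_bounded (C := ‖f‖) (fun n y => f.norm_coe_le_norm _) ?_
  filter_upwards [ae_determined hμ] with y hy
  exact (f.continuous.tendsto y).comp (tendsto_of_phaseMod_eq hy fun n => hrep n y)

/-! ### Invariant measures -/

/-- The double sum of increments telescopes in one variable. -/
theorem abs_sum_sum_sub_le {F : ℕ → ℕ → ℝ} {C : ℝ} (hF : ∀ a b, |F a b| ≤ C) (N : ℕ) :
    |∑ b ∈ Finset.range N, ∑ a ∈ Finset.range N, (F (a + 1) b - F a b)| ≤ 2 * C * N := by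
  have htel : ∀ b, ∑ a ∈ Finset.range N, (F (a + 1) b - F a b) = F N b - F 0 b := fun b =>
    Finset.sum_range_sub (fun a => F a b) N
  simp only [htel]
  refine (Finset.abs_sum_le_sum_abs _ _).trans ?_
  refine (Finset.sum_le_card_nsmul _ _ (2 * C) fun b _ => ?_).trans ?_
  · have h1 := abs_le.1 (hF N b)
    have h2 := abs_le.1 (hF 0 b)
    rw [abs_le]; constructor <;> linarith
  · simp [mul_comm]

/-- The uniform distribution on the translates of the inflation tiling by the vectors of an
`(N + 1) × (N + 1)` box. -/
noncomputable def boxMeasure (N : ℕ) : Measure chairShift.Pt :=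
  ((N + 1 : ENNReal) * (N + 1))⁻¹ • ∑ b ∈ Finset.range (N + 1), ∑ a ∈ Finset.range (N + 1),
    Measure.dirac (chairShift.S ![(a : ℤ), b] chairPt)

instance (N : ℕ) : IsProbabilityMeasure (boxMeasure N) := by
  constructor
  simp only [boxMeasure, Measure.smul_apply, Measure.finsetSum_apply, measure_univ,
    Finset.sum_const, Finset.card_range, smul_eq_mul, nsmul_eq_mul, mul_one, Nat.cast_add,
    Nat.cast_one]
  exact ENNReal.inv_mul_cancel (by simp) (by finiteness)

theorem integral_boxMeasure (N : ℕ) (f : BoundedContinuousFunction chairShift.Pt ℝ) :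
    ∫ y, f y ∂boxMeasure N = (((N : ℝ) + 1) * (N + 1))⁻¹ * ∑ b ∈ Finset.range (N + 1),
      ∑ a ∈ Finset.range (N + 1), f (chairShift.S ![(a : ℤ), b] chairPt) := by
  have hint : ∀ y, Integrable f (Measure.dirac y) := fun y => f.integrable _
  rw [boxMeasure, integral_smul_measure, integral_finsetSum_measure]
  · have hN : ((N : ENNReal) + 1).toReal = N + 1 := by
      rw [ENNReal.toReal_add (by finiteness) (by finiteness)]; simp
    congr 1
    · rw [ENNReal.toReal_inv, ENNReal.toReal_mul, hN]
    · refine Finset.sum_congr rfl fun b _ => ?_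
      rw [integral_finsetSum_measure fun a _ => hint _]
      simp
  · intro b _
    exact integrable_finsetSum_measure.2 fun a _ => hint _

/-- Invariant probability measures exist, as limits of the uniform distributions on boxes along an
ultrafilter. -/
theorem exists_isInvariantProb : ∃ μ, chairShift.IsInvariantProb μ := by
  let ν : ℕ → ProbabilityMeasure chairShift.Pt := fun N => ⟨boxMeasure N, inferInstance⟩
  obtain ⟨μ, hμ⟩ : ∃ μ, Filter.Tendsto ν (Filter.hyperfilter ℕ) (nhds μ) :=
    ⟨_, ((Filter.hyperfilter ℕ).map ν).le_nhds_lim⟩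
  have hlim := ProbabilityMeasure.tendsto_iff_forall_integral_tendsto.1 hμ
  -- a shift that moves the boxes by a small part only
  have hstep : ∀ e : Fin 2 → ℤ, (∀ (f : BoundedContinuousFunction chairShift.Pt ℝ) (N : ℕ),
      |∑ b ∈ Finset.range (N + 1), ∑ a ∈ Finset.range (N + 1),
        (f (chairShift.S e (chairShift.S ![(a : ℤ), b] chairPt)) -
          f (chairShift.S ![(a : ℤ), b] chairPt))| ≤ 2 * ‖f‖ * (N + 1)) →
      MeasurePreserving (chairShift.S e) (μ : Measure chairShift.Pt) μ := by
    intro e he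
    have hcont := (chairShift.S e).continuous
    refine ⟨hcont.measurable, ?_⟩
    have : IsProbabilityMeasure ((μ : Measure chairShift.Pt).map (chairShift.S e)) :=
      Measure.isProbabilityMeasure_map hcont.measurable.aemeasurable
    refine ext_of_forall_integral_eq_of_IsFiniteMeasure fun f => ?_
    rw [integral_map hcont.measurable.aemeasurable f.continuous.aestronglyMeasurable]
    have h1 := hlim f
    have h2 := hlim (f.compContinuous ⟨chairShift.S e, hcont⟩)
    refine tendsto_nhds_unique h2 ?_
    have h3 : Filter.Tendsto (fun N : ℕ => 2 * ‖f‖ * ((N : ℝ) + 1)⁻¹) (Filter.hyperfilter ℕ)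
        (nhds (2 * ‖f‖ * 0)) :=
      (tendsto_const_nhds.mul (tendsto_inv_atTop_zero.comp
        (Filter.tendsto_atTop_add_const_right _ _ tendsto_natCast_atTop_atTop))).mono_left
        Nat.hyperfilter_le_atTop
    rw [mul_zero] at h3
    have h4 := squeeze_zero_norm (f := fun N : ℕ =>
      ∫ y, f.compContinuous ⟨chairShift.S e, hcont⟩ y ∂(ν N : Measure chairShift.Pt) -
        ∫ y, f y ∂(ν N : Measure chairShift.Pt)) (fun N => ?_) h3
    · simpa using h4.add h1
    · simp only [ν, ProbabilityMeasure.coe_mk, integral_boxMeasure]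
      rw [← mul_sub, ← Finset.sum_sub_distrib]
      simp only [← Finset.sum_sub_distrib]
      rw [Real.norm_eq_abs, abs_mul, abs_of_nonneg (by positivity)]
      refine (mul_le_mul_of_nonneg_left (he f N) (by positivity)).trans (le_of_eq ?_)
      field_simp
  have h0 : MeasurePreserving (chairShift.S (Pi.single 0 1)) (μ : Measure chairShift.Pt) μ := by
    have hmove : ∀ a b : ℕ, chairShift.S (Pi.single 0 1) (chairShift.S ![(a : ℤ), b] chairPt) =
        chairShift.S ![((a + 1 : ℕ) : ℤ), b] chairPt := fun a b => by
      rw [S_apply_apply]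
      congr 2
      funext i; fin_cases i <;> simp [add_comm]
    refine hstep _ fun f N => ?_
    have := abs_sum_sum_sub_le (F := fun a b => f (chairShift.S ![(a : ℤ), b] chairPt))
      (fun a b => f.norm_coe_le_norm _) (N + 1)
    rw [Nat.cast_add_one] at this
    simpa only [hmove] using this
  have h1 : MeasurePreserving (chairShift.S (Pi.single 1 1)) (μ : Measure chairShift.Pt) μ := by
    have hmove : ∀ a b : ℕ, chairShift.S (Pi.single 1 1) (chairShift.S ![(b : ℤ), a] chairPt) =
        chairShift.S ![(b : ℤ), (a + 1 : ℕ)] chairPt := fun a b => by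
      rw [S_apply_apply]
      congr 2
      funext i; fin_cases i <;> simp [add_comm]
    refine hstep _ fun f N => ?_
    have := abs_sum_sum_sub_le (F := fun a b => f (chairShift.S ![(b : ℤ), a] chairPt))
      (fun a b => f.norm_coe_le_norm _) (N + 1)
    rw [Finset.sum_comm]
    rw [Nat.cast_add_one] at this
    simpa only [hmove] using this
  refine ⟨μ, inferInstance, ?_⟩
  -- the vectors whose shift preserves the measure form a subgroup
  let G : AddSubgroup (Fin 2 → ℤ) :=
    { carrier := {k | MeasurePreserving (chairShift.S k) (μ : Measure chairShift.Pt) μ}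
      zero_mem' := by
        rw [Set.mem_ofPred_eq, S_zero]; exact MeasurePreserving.id _
      add_mem' := fun {k l} hk hl => by
        rw [Set.mem_ofPred_eq, S_add]; exact hk.comp hl
      neg_mem' := fun {k} hk => by
        have : chairShift.S (-k) = (chairShift.S k)⁻¹ := by
          rw [eq_inv_iff_mul_eq_one, ← S_add, neg_add_cancel, S_zero]
        rw [Set.mem_ofPred_eq, this]
        exact hk.symm (chairShift.S k).toMeasurableEquiv }
  intro k
  have hk : k = k 0 • Pi.single 0 1 + k 1 • Pi.single 1 1 := by
    funext i; fin_cases i <;> simp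
  rw [hk]
  exact G.add_mem (G.zsmul_mem h0 _) (G.zsmul_mem h1 _)

theorem chairShift_hasPurePointSpectrum : chairShift.HasPurePointSpectrum :=
  ⟨exists_isInvariantProb, fun _ hμ => dense_span_eigenfunctions hμ⟩

theorem mainTheorem1 :
    chairShift.IsFaithful ∧
    chairShift.IsHypercubic ∧
    chairShift.HasPurePointSpectrum ∧
    chairShift.symmetryGroup = chairShift.shiftGroup ∧
    (∃ K : Subgroup (chairShift.Pt ≃ₜ chairShift.Pt),
      IsInternalSemidirect chairShift.extendedSymmetryGroup chairShift.shiftGroup K ∧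
      ∃ e : K ≃* hyperoctahedral 2,
        ∀ h : K, chairShift.ConjActsBy (h : chairShift.Pt ≃ₜ chairShift.Pt)
          (e h : GL (Fin 2) ℤ)) ∧
    Nonempty (hyperoctahedral 2 ≃* DihedralGroup 4) ∧
    Maximal (fun K : Subgroup (GL (Fin 2) ℤ) => Finite K) (hyperoctahedral 2) :=
  ⟨chairShift_isFaithful, chairShift_isHypercubic, chairShift_hasPurePointSpectrum,
    chairShift_symmetryGroup, chairShift_semidirect, nonempty_hyperoctahedral_mulEquiv,
    hyperoctahedral_maximal⟩
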